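/- An instance of unweighted Simultaneous Nearest Neighbor search with $k$ queries consists of a metric space $(X,\mathrm{dist})$, a finite nonempty set $P\subseteq X$ of data points, query points $q_1,\dots,q_k\in X$, and a compatibility graph $G$ on the queries: a finite loopless undirected graph, in which parallel edges are allowed, with vertex set $\{1,\dots,k\}$. For $S\subseteq X$ let $$\mathrm{Cost}(Q,G,S)=\min_{p_1,\dots,p_k\in S}\ \sum_{i=1}^k \mathrm{dist}(p_i,q_i)+\sum_{(i,j)\in E(G)}\mathrm{dist}(p_i,p_j).$$ The INN (Independent Nearest Neighbors) algorithm picks for every $q_i$ a nearest neighbor $\hat p_i\in P$ (ties are broken arbitrarily) and replaces $P$ by $\hat P=\{\hat p_1,\dots,\hat p_k\}$. The pruning gap of an instance (with chosen nearest neighbors) is $\mathrm{Cost}(Q,G,\hat P)/\mathrm{Cost}(Q,G,P)\in[0,\infty]$, with the conventions $0/0=0$ and $a/0=\infty$ for $a>0$. The pruning gap $\alpha$ of INN on a class of instances is the supremum of the pruning gaps over all instances in the class and all choices of nearest neighbors. The pseudoarboricity of $G$ is the least $r$ such that the edges of $G$ can be oriented with all out-degrees at most $r$. The space $(X,\mathrm{dist})$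 is $\delta$-padded decomposable if for every $r>0$ there is a random partition of $X$ into clusters of diameter at most $r$ such that any two points $x_1,x_2\in X$ lie in different clusters with probability at most $\delta\,\mathrm{dist}(x_1,x_2)/r$. **Theorem.** There are absolute constants $C,c>0$ such that the following hold. 1. For every $k\ge 3$, on the instances with $k$ queries, $\alpha\le C\,\dfrac{\log k}{\log\log k}$. 2. For every $\delta$-padded decomposable metric space $(X,\mathrm{dist})$ and every $k$, on the instances with $k$ queries in $X$, $\alpha\le C\,\delta$. 3. For all integers $r,k\ge 0$, on the instances with $k$ queries whose compatibility graph has pseudoarboricity $r$, $\alpha\le C\max\{1,r\}$. 4. For every $k$ there is an instance with $k$ distinct query points whose pruning gap is at least $c\sqrt{\log k}$, for every choice of the nearest neighbors. 5. For all integers $k,r\ge 0$ with $r\le\sqrt{\log k}$ there is an instance with $k$ distinct query points, whose compatibility graph has pseudoarboricity $r$, and whose pruning gap is at least $c\,r$, for every choice of the nearest neighbors. (For $k=0$, read $\log 0$ as $0$.) -/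

import Mathlib

open scoped ENNReal

universe u

namespace SNN

/-- A finite loopless undirected multigraph with vertex set `V` (parallel edges are allowed).
The endpoints of the edge `e` are `fst e` and `snd e`, listed in an arbitrary order. -/
structure Multigraph (V : Type) where
  Edge : Type
  [fintypeEdge : Fintype Edge]
  fst : Edge → V
  snd : Edge → V
  loopless : ∀ e, fst e ≠ snd e

attribute [instance] Multigraph.fintypeEdge

/-- The edges of `G` can be oriented with all out-degrees at most `r`;
`tail e` is the vertex at which the oriented edge `e` starts. -/
def Multigraph.HasOrientation {V : Type} (G : Multigraph V) (r : ℕ) : Prop :=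
  ∃ tail : G.Edge → V, (∀ e, tail e = G.fst e ∨ tail e = G.snd e) ∧
    ∀ v : V, Nat.card {e : G.Edge // tail e = v} ≤ r

/-- The pseudoarboricity: the least `r` such that the edges can be oriented with all out-degrees
at most `r`. -/
noncomputable def Multigraph.pseudoarboricity {V : Type} (G : Multigraph V) : ℕ :=
  sInf {r : ℕ | G.HasOrientation r}

theorem Multigraph.hasOrientation_pseudoarboricity {V : Type} (G : Multigraph V) :
    G.HasOrientation G.pseudoarboricity := by
  refine Nat.sInf_mem (s := {r : ℕ | G.HasOrientation r})
    ⟨Nat.card G.Edge, G.fst, fun e => Or.inl rfl, fun v => ?_⟩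
  exact Nat.card_le_card_of_injective _ Subtype.val_injective

/-- An instance of (unweighted) Simultaneous Nearest Neighbor in the metric space `X` with `k`
queries: a nonempty finite set `P` of data points, the query points `q 0, …, q (k - 1)` and a
compatibility graph on the (indices of the) queries. -/
structure SNNInstance (X : Type u) [MetricSpace X] (k : ℕ) where
  P : Set X
  finite_P : P.Finite
  nonempty_P : P.Nonempty
  q : Fin k → X
  G : Multigraph (Fin k)

namespace SNNInstance

variable {X : Type u} [MetricSpace X] {k : ℕ}

/-- The cost of the assignment of the label `p i` to the query `q i`. -/
noncomputable def assignmentCost (I : SNNInstance X k) (p : Fin k → X) : ℝ :=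
  ∑ i, dist (p i) (I.q i) + ∑ e : I.G.Edge, dist (p (I.G.fst e)) (p (I.G.snd e))

/-- The optimal cost `Cost(Q, G, S)` of an assignment with labels from the set `S`. -/
noncomputable def cost (I : SNNInstance X k) (S : Set X) : ℝ :=
  ⨅ p : Fin k → S, I.assignmentCost (fun i => (p i : X))

/-- `nn i` is a nearest neighbor of the query `q i` in `P`, for every `i`. Ties may be broken
arbitrarily. -/
def IsNearest (I : SNNInstance X k) (nn : Fin k → X) : Prop :=
  ∀ i, nn i ∈ I.P ∧ ∀ p ∈ I.P, dist (I.q i) (nn i) ≤ dist (I.q i) p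

/-- The pruning gap `Cost(Q, G, P̂) / Cost(Q, G, P)` where `P̂` is the set of the nearest neighbors
`nn i` found by the algorithm. The quotient is taken in `[0, ∞]`, where `a / 0 = ∞` for `a > 0`
and `0 / 0 = 0`. -/
noncomputable def pruningGap (I : SNNInstance X k) (nn : Fin k → X) : ℝ≥0∞ :=
  ENNReal.ofReal (I.cost (Set.range nn)) / ENNReal.ofReal (I.cost I.P)

end SNNInstance

/-- The pruning gap of the INN algorithm on the instances with `k` queries: the supremum over all
metric spaces, all instances, and all choices of the nearest neighbors. -/
noncomputable def innGap (k : ℕ) : ℝ≥0∞ :=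
  ⨆ (X : Type u) (_ : MetricSpace X) (I : SNNInstance X k) (nn : Fin k → X)
    (_ : I.IsNearest nn), I.pruningGap nn

/-- The pruning gap of the INN algorithm on the instances with `k` queries in the metric
space `X`. -/
noncomputable def innGapOn (X : Type u) [MetricSpace X] (k : ℕ) : ℝ≥0∞ :=
  ⨆ (I : SNNInstance X k) (nn : Fin k → X) (_ : I.IsNearest nn), I.pruningGap nn

/-- The pruning gap of the INN algorithm on the instances with `k` queries whose compatibility
graph has pseudoarboricity `r`. -/
noncomputable def innGapPseudoarb (r k : ℕ) : ℝ≥0∞ :=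
  ⨆ (X : Type u) (_ : MetricSpace X) (I : SNNInstance X k)
    (_ : I.G.pseudoarboricity = r) (nn : Fin k → X) (_ : I.IsNearest nn), I.pruningGap nn

/-- `X` is `δ`-padded decomposable: for every `r > 0` there is a random partition of `X` (a random
equivalence relation `part`, whose classes are the clusters) with all clusters of diameter at most
`r`, such that any two points `x, y` are in different clusters with probability at most
`δ * dist x y / r`. -/
def PaddedDecomposable (X : Type u) [MetricSpace X] (δ : ℝ) : Prop :=
  ∀ r : ℝ, 0 < r →
    ∃ (Ω : Type u) (_ : MeasurableSpace Ω) (μ : MeasureTheory.Measure Ω)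
      (_ : MeasureTheory.IsProbabilityMeasure μ) (part : Ω → Setoid X),
      (∀ ω x y, part ω x y → dist x y ≤ r) ∧
      ∀ x y, MeasurableSet {ω | ¬ part ω x y} ∧
        μ.real {ω | ¬ part ω x y} ≤ δ * dist x y / r

end SNN

/-! The upper bounds come from rounding. By `pruningGap_le` it suffices to turn any assignment p
with labels in P into one with labels among the chosen nearest neighbors (the terminals) at bounded
loss. Let D_i be the distance from p_i to its nearest terminal. Then D_i ≤ 2 dist(p_i, q_i), and D
is 1-Lipschitz along the labels. If each p_i moves to its nearest terminal, an edge grows by at most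
the sum of D over its ends, which up to the edge length can be charged to the tail of an
orientation; out-degrees at most r give O(r).

For the other two upper bounds, `exists_rounding` groups labels by the scale of D (log D, rounded
down after a random shift), partitions each group into clusters of diameter about e^j D, and sends a
whole cluster to the terminal nearest to one representative. A label then moves O((1 + e^j) D), and
the only edges not yet paid for are those short compared with D and cut by a partition. With j = 0,
a padded decomposition cuts an edge of length d with probability O(δ d / D), for an expected extra
cost O(δ d). In a general metric, `exists_partition_card_cut_le` bounds the cuts by d / (e^j D)
times the logarithmic growth of balls near scale e^j D. The factor e^j cancels, the growth
telescopes over j to O(log k), and the movement costs over m scales form a geometric sum O(e^m).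
With m about log log k, some scale loses only O(log k / log log k).

For the lower bounds, take a graph of girth at least 2R + 2 with degrees at most 8 and at least 3k
edges, R of order log k, and attach a spine of length r to each vertex. Queries sit at the tips and
are their own nearest neighbors. Using the feet of the spines costs O(k r). Labels restricted to
tips define a map f on vertices. Either a constant fraction of the vertices moves farther than R,
or, by the girth, at least k edges of multiplicity about r / 8 are cut at cost 2r each
(`LocallyAcyclic.card_orderedEdges_le`). Both cost Ω(k r²) when r² = O(R). A bundle of 2r parallel
edges makes the pseudoarboricity exactly r. -/

namespace SNN

/-! ### Pruning gaps from individual assignments; distances to terminals -/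

namespace SNNInstance

variable {X : Type u} [MetricSpace X] {k : ℕ}

theorem assignmentCost_nonneg (I : SNNInstance X k) (p : Fin k → X) : 0 ≤ I.assignmentCost p :=
  add_nonneg (Finset.sum_nonneg fun _ _ => dist_nonneg) (Finset.sum_nonneg fun _ _ => dist_nonneg)

theorem bddBelow_assignmentCost (I : SNNInstance X k) (S : Set X) :
    BddBelow (Set.range fun p : Fin k → S => I.assignmentCost fun i => (p i : X)) :=
  ⟨0, by rintro _ ⟨p, rfl⟩; exact I.assignmentCost_nonneg _⟩

theorem cost_le (I : SNNInstance X k) {S : Set X} {p : Fin k → X} (hp : ∀ i, p i ∈ S) :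
    I.cost S ≤ I.assignmentCost p :=
  ciInf_le (I.bddBelow_assignmentCost S) fun i => ⟨p i, hp i⟩

/-- Rounding every assignment, not only an optimal one, passes to the infimum and also covers
optimal cost 0: the numerator then vanishes as well, and 0/0 = 0. -/
theorem pruningGap_le (I : SNNInstance X k) {nn : Fin k → X} {A : ℝ} (hA : 0 ≤ A)
    (h : ∀ p : Fin k → X, (∀ i, p i ∈ I.P) →
      ∃ p' : Fin k → X, (∀ i, p' i ∈ Set.range nn) ∧
        I.assignmentCost p' ≤ A * I.assignmentCost p) :
    I.pruningGap nn ≤ ENNReal.ofReal A := by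
  have : Nonempty I.P := I.nonempty_P.to_subtype
  refine ENNReal.div_le_of_le_mul ?_
  rw [← ENNReal.ofReal_mul hA]
  refine ENNReal.ofReal_le_ofReal ?_
  rw [cost.eq_def I I.P, Real.mul_iInf_of_nonneg hA]
  refine le_ciInf fun p => ?_
  obtain ⟨p', hp', hle⟩ := h (fun i => p i) fun i => (p i).2
  exact (I.cost_le hp').trans hle

theorem le_pruningGap (I : SNNInstance X k) {nn : Fin k → X} {c B : ℝ} (hc : 0 ≤ c) (hB : 0 < B)
    {p : Fin k → X} (hp : ∀ i, p i ∈ I.P) (hpB : I.assignmentCost p ≤ B)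
    (h : ∀ p' : Fin k → X, (∀ i, p' i ∈ Set.range nn) → c * B ≤ I.assignmentCost p') :
    ENNReal.ofReal c ≤ I.pruningGap nn := by
  have hne : Nonempty (Fin k → Set.range nn) := ⟨fun i => ⟨nn i, i, rfl⟩⟩
  have h1 : c * B ≤ I.cost (Set.range nn) := le_ciInf fun p' => h _ fun i => (p' i).2
  have h2 : I.cost I.P ≤ B := (I.cost_le hp).trans hpB
  calc ENNReal.ofReal c = ENNReal.ofReal (c * B) / ENNReal.ofReal B := by
        rw [ENNReal.ofReal_mul hc, ENNReal.mul_div_cancel_right] <;> simp [hB]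
    _ ≤ _ := ENNReal.div_le_div (ENNReal.ofReal_le_ofReal h1) (ENNReal.ofReal_le_ofReal h2)

/-- A choice of nearest terminals to the points `p i`. -/
theorem exists_nearest_terminal (nn p : Fin k → X) :
    ∃ τ : Fin k → Fin k, ∀ i j, dist (p i) (nn (τ i)) ≤ dist (p i) (nn j) := by
  have : ∀ i, ∃ t, ∀ j, dist (p i) (nn t) ≤ dist (p i) (nn j) := fun i => by
    have : Nonempty (Fin k) := ⟨i⟩
    exact Finite.exists_min fun j => dist (p i) (nn j)
  choose τ hτ using this
  exact ⟨τ, hτ⟩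

/-- The terminal `nn i` is already close enough: it is no farther from `q i` than `p i` is. -/
theorem dist_nearest_terminal_le (I : SNNInstance X k) {nn p : Fin k → X} (hnn : I.IsNearest nn)
    (hp : ∀ i, p i ∈ I.P) {τ : Fin k → Fin k}
    (hτ : ∀ i j, dist (p i) (nn (τ i)) ≤ dist (p i) (nn j)) (i : Fin k) :
    dist (p i) (nn (τ i)) ≤ 2 * dist (p i) (I.q i) := by
  have h1 := hτ i i
  have h2 := dist_triangle (p i) (I.q i) (nn i)
  have h3 := (hnn i).2 (p i) (hp i)
  rw [dist_comm (I.q i) (p i)] at h3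
  linarith

theorem dist_nearest_terminal_lipschitz {nn p : Fin k → X} {τ : Fin k → Fin k}
    (hτ : ∀ i j, dist (p i) (nn (τ i)) ≤ dist (p i) (nn j)) (i j : Fin k) :
    dist (p i) (nn (τ i)) ≤ dist (p j) (nn (τ j)) + dist (p i) (p j) := by
  have h1 := hτ i (τ j)
  have h2 := dist_triangle (p i) (p j) (nn (τ j))
  linarith

end SNNInstance

/-! ### Upper bound for bounded pseudoarboricity -/

theorem Multigraph.sum_tail_le {V : Type} [Fintype V] (G : Multigraph V) {r : ℕ}
    {tail : G.Edge → V} (h : ∀ v : V, Nat.card {e : G.Edge // tail e = v} ≤ r) {f : V → ℝ}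
    (hf : ∀ v, 0 ≤ f v) : ∑ e, f (tail e) ≤ r * ∑ v, f v := by
  classical
  calc ∑ e, f (tail e) = ∑ v, ∑ e with tail e = v, f (tail e) :=
        (Finset.sum_fiberwise _ _ _).symm
    _ = ∑ v, (Nat.card {e : G.Edge // tail e = v} : ℝ) * f v := by
        refine Finset.sum_congr rfl fun v _ => ?_
        rw [Finset.sum_congr rfl (g := fun _ => f v) (by simp +contextual)]
        simp [Fintype.card_subtype]
    _ ≤ ∑ v, r * f v := by
        refine Finset.sum_le_sum fun v _ => mul_le_mul_of_nonneg_right ?_ (hf v)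
        exact_mod_cast h v
    _ = r * ∑ v, f v := by rw [Finset.mul_sum]

/-- Rounding to nearest terminals works. The Lipschitz property replaces the detour at the head of
an edge by the one at its tail plus the edge length, so queries pay 3 + 4r times and edges twice
their original cost. -/
theorem innGapPseudoarb_le (r k : ℕ) :
    innGapPseudoarb.{u} r k ≤ ENNReal.ofReal (7 * max 1 (r : ℝ)) := by
  simp only [innGapPseudoarb, iSup_le_iff]
  intro X _ I hr nn hnn
  have hm1 : (1 : ℝ) ≤ max 1 (r : ℝ) := le_max_left _ _
  have hm2 : (r : ℝ) ≤ max 1 (r : ℝ) := le_max_right _ _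
  refine I.pruningGap_le (by positivity) fun p hp => ?_
  obtain ⟨τ, hτ⟩ := SNNInstance.exists_nearest_terminal nn p
  refine ⟨fun i => nn (τ i), fun i => ⟨_, rfl⟩, ?_⟩
  obtain ⟨tail, htail, hout⟩ := hr ▸ I.G.hasOrientation_pseudoarboricity
  have hD := I.dist_nearest_terminal_le hnn hp hτ
  have hL := SNNInstance.dist_nearest_terminal_lipschitz hτ
  have hv : ∀ i, dist (nn (τ i)) (I.q i) ≤ 3 * dist (p i) (I.q i) := fun i => by
    have h1 := dist_triangle (nn (τ i)) (p i) (I.q i)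
    rw [dist_comm (nn (τ i)) (p i)] at h1
    linarith [hD i]
  have he : ∀ e : I.G.Edge, dist (nn (τ (I.G.fst e))) (nn (τ (I.G.snd e))) ≤
      4 * dist (p (tail e)) (I.q (tail e)) + 2 * dist (p (I.G.fst e)) (p (I.G.snd e)) := by
    intro e
    have h1 := dist_triangle4 (nn (τ (I.G.fst e))) (p (I.G.fst e)) (p (I.G.snd e))
      (nn (τ (I.G.snd e)))
    rw [dist_comm (nn (τ (I.G.fst e))) (p (I.G.fst e))] at h1
    rcases htail e with h | h <;> rw [h]
    · have h2 := hL (I.G.snd e) (I.G.fst e)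
      rw [dist_comm (p (I.G.snd e)) (p (I.G.fst e))] at h2
      linarith [hD (I.G.fst e)]
    · have h2 := hL (I.G.fst e) (I.G.snd e)
      linarith [hD (I.G.snd e)]
  have hs := I.G.sum_tail_le hout (f := fun v => dist (p v) (I.q v)) fun _ => dist_nonneg
  have hQ : 0 ≤ ∑ i, dist (p i) (I.q i) := Finset.sum_nonneg fun _ _ => dist_nonneg
  have hE : 0 ≤ ∑ e : I.G.Edge, dist (p (I.G.fst e)) (p (I.G.snd e)) :=
    Finset.sum_nonneg fun _ _ => dist_nonneg
  have h1 := Finset.sum_le_sum fun i (_ : i ∈ Finset.univ) => hv i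
  have h2 := Finset.sum_le_sum fun i (_ : i ∈ Finset.univ) => he i
  rw [Finset.sum_add_distrib, ← Finset.mul_sum, ← Finset.mul_sum] at h2
  rw [← Finset.mul_sum] at h1
  simp only [SNNInstance.assignmentCost]
  nlinarith [mul_le_mul_of_nonneg_right hm1 hQ, mul_le_mul_of_nonneg_right hm1 hE,
    mul_le_mul_of_nonneg_right hm2 hQ]

/-! ### Graphs of large girth and nearly regular degree -/

section HighGirth

variable {V : Type*}

/-- Every subgraph with fewer than `g` edges is a forest; for a finite graph this says that the
girth is at least `g`. -/
def LocallyAcyclic (g : ℕ) (G : SimpleGraph V) : Prop :=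
  ∀ F ≤ G, F.edgeSet.ncard < g → F.IsAcyclic

theorem snd_transfer {G F : SimpleGraph V} {u v : V} (p : G.Walk u v)
    (h : ∀ e ∈ p.edges, e ∈ F.edgeSet) : (p.transfer F h).snd = p.snd := by
  cases p with
  | nil => rfl
  | cons hadj q =>
    exact (SimpleGraph.Walk.snd_cons (q.transfer F fun e he => h e (by simp [he]))
      (F.mem_edgeSet.1 (h _ (by simp)))).trans (SimpleGraph.Walk.snd_cons q hadj).symm

theorem ncard_edges_le_length {G : SimpleGraph V} {u v : V} (p : G.Walk u v) :
    {e | e ∈ p.edges}.ncard ≤ p.length := by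
  classical
  have : {e | e ∈ p.edges} = (p.edges.toFinset : Set (Sym2 V)) := by ext; simp
  rw [this, Set.ncard_coe_finset, ← p.length_edges]
  exact List.toFinset_card_le _

/-- In a graph of large girth, an edge joining two vertices with short paths to the same root is
the first edge of one of these paths. -/
theorem LocallyAcyclic.eq_snd_or_eq_snd {g : ℕ} {G : SimpleGraph V} (hG : LocallyAcyclic g G)
    {a b t t' : V} {p : G.Walk a t} {q : G.Walk b t'} (ht : t = t') (hp : p.IsPath)
    (hq : q.IsPath) (hlen : p.length + q.length + 1 < g) (hab : G.Adj a b) :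
    b = p.snd ∨ a = q.snd := by
  subst ht
  let s : Set (Sym2 V) := {e | e ∈ p.edges} ∪ {e | e ∈ q.edges} ∪ {s(a, b)}
  have hsG : s ⊆ G.edgeSet := by
    rintro e ((he | he) | rfl)
    exacts [p.edges_subset_edgeSet he, q.edges_subset_edgeSet he, hab]
  have hF : (SimpleGraph.fromEdgeSet s).edgeSet = s := by
    rw [SimpleGraph.edgeSet_fromEdgeSet]
    exact sdiff_eq_left.2 ((Set.disjoint_left.2 fun e he hd =>
      G.not_isDiag_of_mem_edgeSet (hsG he) hd))
  have hcard : s.ncard < g := by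
    have h1 := ncard_edges_le_length p
    have h2 := ncard_edges_le_length q
    have h3 := Set.ncard_union_le ({e | e ∈ p.edges} ∪ {e | e ∈ q.edges}) {s(a, b)}
    have h4 := Set.ncard_union_le {e | e ∈ p.edges} {e | e ∈ q.edges}
    rw [Set.ncard_singleton] at h3
    simp only [s]
    omega
  have hac : (SimpleGraph.fromEdgeSet s).IsAcyclic := by
    refine hG _ ?_ (by rwa [hF])
    rw [← SimpleGraph.edgeSet_subset_edgeSet, hF]
    exact hsG
  have hps : ∀ e ∈ p.edges, e ∈ (SimpleGraph.fromEdgeSet s).edgeSet := fun e he => by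
    rw [hF]; exact Or.inl (Or.inl he)
  have hqs : ∀ e ∈ q.edges, e ∈ (SimpleGraph.fromEdgeSet s).edgeSet := fun e he => by
    rw [hF]; exact Or.inl (Or.inr he)
  have habs : (SimpleGraph.fromEdgeSet s).Adj a b := by
    rw [← SimpleGraph.mem_edgeSet, hF]; exact Or.inr rfl
  have hp' := hp.transfer hps
  have hq' := hq.transfer hqs
  -- The two paths and the edge have fewer than g edges, hence form a forest. In it, a neighbor of
  -- the start of a path that lies on the path must be its second vertex; if b is not on the path
  -- from a, then a is on the path from b.
  by_cases hb : b ∈ (p.transfer _ hps).support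
  · exact Or.inl ((hac.eq_snd_of_adj_start hp' habs hb).trans (snd_transfer p hps))
  · have ha := hac.mem_support_of_ne_mem_support_of_adj_of_isPath hq'.reverse hp'.reverse habs.symm
      (by simpa using hb)
    rw [SimpleGraph.Walk.support_reverse, List.mem_reverse] at ha
    exact Or.inr ((hac.eq_snd_of_adj_start hq' habs.symm ha).trans (snd_transfer q hqs))

variable [Finite V]

theorem ncard_reachable_within_le {G : SimpleGraph V} {d : ℕ}
    (hd : ∀ v, (G.neighborSet v).ncard ≤ d) (u : V) (n : ℕ) :
    {v | ∃ w : G.Walk v u, w.length ≤ n}.ncard ≤ (d + 1) ^ n := by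
  induction n with
  | zero =>
    have : {v | ∃ w : G.Walk v u, w.length ≤ 0} ⊆ {u} := by
      rintro v ⟨w, hw⟩
      exact SimpleGraph.Walk.eq_of_length_eq_zero (Nat.le_zero.1 hw)
    simp only [pow_zero]
    exact (Set.ncard_le_ncard this).trans (Set.ncard_singleton _).le
  | succ n ih =>
    set B := {v | ∃ w : G.Walk v u, w.length ≤ n}
    have hsub : {v | ∃ w : G.Walk v u, w.length ≤ n + 1} ⊆
        ⋃ v ∈ B.toFinite.toFinset, insert v (G.neighborSet v) := by
      rintro v ⟨w, hw⟩
      simp only [Set.Finite.mem_toFinset, Set.mem_iUnion]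
      cases w with
      | nil => exact ⟨u, ⟨.nil, Nat.zero_le n⟩, Or.inl rfl⟩
      | cons h w => exact ⟨_, ⟨w, by simpa using hw⟩, Or.inr h.symm⟩
    calc _ ≤ (⋃ v ∈ B.toFinite.toFinset, insert v (G.neighborSet v)).ncard :=
          Set.ncard_le_ncard hsub
      _ ≤ ∑ v ∈ B.toFinite.toFinset, (insert v (G.neighborSet v)).ncard :=
          Finset.set_ncard_biUnion_le _ _
      _ ≤ ∑ v ∈ B.toFinite.toFinset, (d + 1) :=
          Finset.sum_le_sum fun v _ =>
            (Set.ncard_insert_le _ _).trans (Nat.add_le_add_right (hd v) 1)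
      _ = B.ncard * (d + 1) := by
          rw [Finset.sum_const, smul_eq_mul, Set.ncard_eq_toFinset_card _]
      _ ≤ (d + 1) ^ n * (d + 1) := Nat.mul_le_mul_right _ ih
      _ = _ := (pow_succ _ _).symm

/-- A subgraph with fewer than g edges, with xy removed, is a forest that cannot connect x to y,
since a connecting path would be shorter than g. Restoring xy creates no cycle. -/
theorem LocallyAcyclic.sup_edge {g : ℕ} {G : SimpleGraph V} (hG : LocallyAcyclic g G) {x y : V}
    (hxy : ∀ w : G.Walk x y, g ≤ w.length) : LocallyAcyclic g (G ⊔ SimpleGraph.edge x y) := by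
  intro F hF hcard
  set F' := F.deleteEdges {s(x, y)} with hF'
  have hF'G : F' ≤ G := by
    intro a b hab
    rw [hF', SimpleGraph.deleteEdges_adj] at hab
    rcases hF hab.1 with h | h
    · exact h
    · rw [SimpleGraph.edge_adj] at h
      refine absurd ?_ hab.2
      rcases h.1 with ⟨rfl, rfl⟩ | ⟨rfl, rfl⟩
      · rfl
      · exact Sym2.eq_swap
  have hcard' : F'.edgeSet.ncard < g := (Set.ncard_le_ncard
    (SimpleGraph.edgeSet_subset_edgeSet.2 (F.deleteEdges_le _))).trans_lt hcard
  have hac := hG F' hF'G hcard'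
  have hnr : ¬ F'.Reachable x y := by
    rintro ⟨w⟩
    classical
    have hp := w.bypass_isPath
    have h1 : w.bypass.length ≤ F'.edgeSet.ncard := by
      rw [← w.bypass.length_edges, ← List.toFinset_card_of_nodup hp.isTrail.edges_nodup,
        ← Set.ncard_coe_finset]
      refine Set.ncard_le_ncard fun e he => w.bypass.edges_subset_edgeSet ?_
      simpa using he
    have h2 := hxy (w.bypass.mapLe hF'G)
    rw [SimpleGraph.Walk.length_map] at h2
    omega
  refine (hac.sup_edge_of_not_reachable hnr).anti ?_
  intro a b hab
  by_cases h : s(a, b) = s(x, y)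
  · refine Or.inr ((SimpleGraph.edge_adj _ _ _ _).2 ⟨?_, hab.ne⟩)
    simpa using h
  · exact Or.inl ((SimpleGraph.deleteEdges_adj).2 ⟨hab, h⟩)

open Classical in
theorem ncard_neighborSet_sup_edge_le {G : SimpleGraph V} {x y : V} (v : V) :
    ((G ⊔ SimpleGraph.edge x y).neighborSet v).ncard ≤
      (G.neighborSet v).ncard + if v = x ∨ v = y then 1 else 0 := by
  by_cases hv : v = x ∨ v = y
  · rw [if_pos hv]
    have : (G ⊔ SimpleGraph.edge x y).neighborSet v ⊆
        insert (if v = x then y else x) (G.neighborSet v) := by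
      intro b hb
      rcases hb with h | h
      · exact Or.inr h
      · rw [SimpleGraph.edge_adj] at h
        rcases h.1 with ⟨rfl, rfl⟩ | ⟨rfl, rfl⟩
        · simp
        · simp [h.2]
    exact (Set.ncard_le_ncard this).trans (Set.ncard_insert_le _ _)
  · rw [if_neg hv, add_zero]
    refine Set.ncard_le_ncard ?_
    intro b hb
    rcases hb with h | h
    · exact h
    · rw [SimpleGraph.edge_adj] at h
      exact absurd (h.1.imp (fun h => h.1.symm) fun h => h.2.symm) (by grind)

/-- A graph of large girth and maximum degree `d` which is maximal has degree `d` almost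
everywhere. -/
theorem exists_locallyAcyclic (V : Type*) [Finite V] (d : ℕ) {g : ℕ} (hg : 1 ≤ g) :
    ∃ G : SimpleGraph V, LocallyAcyclic g G ∧ (∀ v, (G.neighborSet v).ncard ≤ d) ∧
      {v | (G.neighborSet v).ncard < d}.ncard ≤ (d + 1) ^ g := by
  obtain ⟨G, -, ⟨hG, hGd⟩, hmax⟩ := (Set.toFinite {G : SimpleGraph V | LocallyAcyclic g G ∧
    ∀ v, (G.neighborSet v).ncard ≤ d}).exists_le_maximal (a := ⊥)
    ⟨fun F hF _ => (le_bot_iff.1 hF) ▸ SimpleGraph.isAcyclic_bot, fun v => by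
      simp [SimpleGraph.neighborSet]⟩
  refine ⟨G, hG, hGd, ?_⟩
  by_contra! hlt
  obtain ⟨u, hu⟩ := Set.nonempty_of_ncard_ne_zero (Nat.ne_zero_of_lt hlt)
  -- There are more vertices of degree below d than fit in the g-ball of u, so one of them lies
  -- farther away and can be joined to u, against maximality.
  obtain ⟨v, hv, hvu⟩ := Set.exists_mem_notMem_of_ncard_lt_ncard
    ((ncard_reachable_within_le hGd u g).trans_lt hlt)
  simp only [Set.mem_ofPred_eq, not_exists, not_le] at hvu hu hv
  have hne : v ≠ u := by
    rintro rfl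
    simpa using hvu .nil
  have h := hmax (y := G ⊔ SimpleGraph.edge v u)
    ⟨hG.sup_edge fun w => (hvu w).le, fun x => ?_⟩ le_sup_left
  · have hadj : G.Adj v u := h (Or.inr (by simp [SimpleGraph.edge_adj, hne]))
    have := hvu (.cons hadj .nil)
    simp at this
    omega
  · have := ncard_neighborSet_sup_edge_le (G := G) (x := v) (y := u) x
    split_ifs at this with hx
    · rcases hx with rfl | rfl <;> omega
    · exact this.trans (hGd x)

end HighGirth

/-! ### Edge counts and cut edges -/

section OrderedEdges

variable {V : Type*} [Fintype V] [LinearOrder V]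

open Classical in
/-- The edges of a graph, with their endpoints in increasing order. -/
noncomputable def orderedEdges (G : SimpleGraph V) : Finset (V × V) :=
  {x | x.1 < x.2 ∧ G.Adj x.1 x.2}

theorem mem_orderedEdges {G : SimpleGraph V} {x : V × V} :
    x ∈ orderedEdges G ↔ x.1 < x.2 ∧ G.Adj x.1 x.2 := by
  simp [orderedEdges]

theorem sum_ncard_neighborSet (G : SimpleGraph V) :
    ∑ v, (G.neighborSet v).ncard = 2 * (orderedEdges G).card := by
  classical
  have h1 : ∑ v, (G.neighborSet v).ncard = (Finset.univ.filter fun x : V × V =>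
      G.Adj x.1 x.2).card := by
    rw [Finset.card_filter, Fintype.sum_prod_type]
    refine Finset.sum_congr rfl fun v _ => ?_
    rw [← Finset.card_filter, Set.ncard_eq_toFinset_card']
    congr 1
    ext; simp
  have h2 : (Finset.univ.filter fun x : V × V => G.Adj x.1 x.2) =
      orderedEdges G ∪ (orderedEdges G).map (Equiv.prodComm V V).toEmbedding := by
    ext ⟨a, b⟩
    simp only [Finset.mem_filter, Finset.mem_univ, true_and, Finset.mem_union, mem_orderedEdges,
      Finset.mem_map_equiv, Equiv.prodComm_symm, Equiv.prodComm_apply, Prod.swap_prod_mk]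
    constructor
    · intro h
      rcases lt_or_gt_of_ne h.ne with h' | h'
      exacts [Or.inl ⟨h', h⟩, Or.inr ⟨h', h.symm⟩]
    · rintro (h | h)
      exacts [h.2, h.2.symm]
  rw [h1, h2, Finset.card_union_of_disjoint, Finset.card_map, two_mul]
  rw [Finset.disjoint_left]
  rintro ⟨a, b⟩ h h'
  simp only [mem_orderedEdges, Finset.mem_map_equiv, Equiv.prodComm_symm, Equiv.prodComm_apply,
    Prod.swap_prod_mk] at h h'
  exact lt_asymm h.1 h'.1

theorem card_orderedEdges_incident_le (G : SimpleGraph V) (v : V) :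
    ((orderedEdges G).filter fun x => x.1 = v ∨ x.2 = v).card ≤ (G.neighborSet v).ncard := by
  classical
  rw [Set.ncard_eq_toFinset_card']
  refine (Finset.card_le_card ?_).trans (Finset.card_image_le
    (s := (G.neighborSet v).toFinset) (f := fun b => if v < b then (v, b) else (b, v)))
  rintro ⟨a, b⟩ h
  simp only [Finset.mem_filter, mem_orderedEdges] at h
  simp only [Finset.mem_image, Set.mem_toFinset, SimpleGraph.mem_neighborSet]
  rcases h with ⟨⟨hlt, hadj⟩, rfl | rfl⟩
  · exact ⟨b, hadj, by simp [hlt]⟩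
  · exact ⟨a, hadj.symm, by simp [hlt.not_gt]⟩

/-- In a graph of large girth every map `f` which moves only few vertices far away cuts many
edges. -/
theorem LocallyAcyclic.card_orderedEdges_le {G : SimpleGraph V} {R d : ℕ}
    (hG : LocallyAcyclic (2 * R + 2) G) (hd : ∀ v, (G.neighborSet v).ncard ≤ d) (f : V → V)
    (B : Finset V) (hB : ∀ v ∉ B, ∃ w : G.Walk v (f v), w.length ≤ R) :
    (orderedEdges G).card ≤
      ((orderedEdges G).filter fun x => f x.1 ≠ f x.2).card + Fintype.card V + d * B.card := by
  classical
  choose w hw using hB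
  -- By the girth, an uncut edge with both ends outside B is {v, par v} for one of its ends v, so
  -- there are at most |V| such edges.
  let par : V → V := fun v => if h : v ∉ B then (w v h).bypass.snd else v
  have hcover : orderedEdges G ⊆ ((orderedEdges G).filter fun x => f x.1 ≠ f x.2) ∪
      Finset.univ.image (fun v => if v < par v then (v, par v) else (par v, v)) ∪
      B.biUnion fun v => (orderedEdges G).filter fun x => x.1 = v ∨ x.2 = v := by
    rintro ⟨a, b⟩ hx
    have hx' := mem_orderedEdges.1 hx
    simp only [Finset.mem_union, Finset.mem_filter, Finset.mem_biUnion, Finset.mem_image, hx,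
      true_and, Finset.mem_univ]
    by_cases hf : f a = f b
    swap
    · exact Or.inl (Or.inl hf)
    by_cases ha : a ∈ B
    · exact Or.inr ⟨a, ha, Or.inl rfl⟩
    by_cases hb : b ∈ B
    · exact Or.inr ⟨b, hb, Or.inr rfl⟩
    have hla := (w a ha).length_bypass_le_length
    have hlb := (w b hb).length_bypass_le_length
    have hwa := hw a ha
    have hwb := hw b hb
    refine Or.inl (Or.inr ?_)
    rcases hG.eq_snd_or_eq_snd hf (w a ha).bypass_isPath (w b hb).bypass_isPath (by omega)
      hx'.2 with h | h
    · refine ⟨a, ?_⟩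
      have : par a = b := by simp only [par, dif_pos ha]; exact h.symm
      simp [this, hx'.1]
    · refine ⟨b, ?_⟩
      have : par b = a := by simp only [par, dif_pos hb]; exact h.symm
      simp [this, hx'.1.not_gt]
  refine (Finset.card_le_card hcover).trans ((Finset.card_union_le _ _).trans
    (Nat.add_le_add ((Finset.card_union_le _ _).trans
      (Nat.add_le_add_left Finset.card_image_le _)) ?_))
  refine (Finset.card_biUnion_le_card_mul _ _ d fun v _ =>
    (card_orderedEdges_incident_le G v).trans (hd v)).trans_eq (mul_comm _ _)

theorem exists_locallyAcyclic_card_orderedEdges {g : ℕ} (hg : 1 ≤ g)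
    (hV : 4 * 9 ^ g ≤ Fintype.card V) :
    ∃ G : SimpleGraph V, LocallyAcyclic g G ∧ (∀ v, (G.neighborSet v).ncard ≤ 8) ∧
      3 * Fintype.card V ≤ (orderedEdges G).card ∧
      (orderedEdges G).card ≤ 4 * Fintype.card V := by
  classical
  obtain ⟨G, hG, hd, hU⟩ := exists_locallyAcyclic V 8 hg
  refine ⟨G, hG, hd, ?_, ?_⟩
  -- At most 9^g ≤ |V| / 4 vertices have deficient degree, each by at most 8, so the degrees sum to
  -- at least 6|V|.
  · have h1 : ∑ v : V, 8 ≤ ∑ v, ((G.neighborSet v).ncard +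
        if (G.neighborSet v).ncard < 8 then 8 else 0) :=
      Finset.sum_le_sum fun v _ => by split_ifs with h <;> omega
    rw [Finset.sum_add_distrib, sum_ncard_neighborSet, ← Finset.sum_filter] at h1
    have h2 : {v | (G.neighborSet v).ncard < 8}.ncard =
        (Finset.univ.filter fun v => (G.neighborSet v).ncard < 8).card := by
      rw [← Set.ncard_coe_finset]; simp
    simp only [Finset.sum_const, Finset.card_univ, smul_eq_mul] at h1
    norm_num at hU
    omega
  · have h1 : ∑ v, (G.neighborSet v).ncard ≤ ∑ v : V, 8 := Finset.sum_le_sum fun v _ => hd v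
    rw [sum_ncard_neighborSet] at h1
    simp only [Finset.sum_const, Finset.card_univ, smul_eq_mul] at h1
    omega

end OrderedEdges

/-! ### The hedgehog metric -/

/-- The truncation of the graph distance at `R + 1`. -/
theorem exists_truncated_dist {V : Type*} (G : SimpleGraph V) (R : ℕ) :
    ∃ ρ : V → V → ℝ, (∀ v, ρ v v = 0) ∧ (∀ u v, ρ u v = ρ v u) ∧
      (∀ u v w, ρ u w ≤ ρ u v + ρ v w) ∧ (∀ u v, 0 ≤ ρ u v) ∧ (∀ u v, u ≠ v → 0 < ρ u v) ∧
      (∀ u v, ρ u v ≤ R + 1) ∧ (∀ u v, G.Adj u v → ρ u v ≤ 1) ∧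
      ∀ u v, (¬ ∃ w : G.Walk u v, w.length ≤ R) → R + 1 ≤ ρ u v := by
  -- Truncation makes the distance finite across components; it also bounds the cost of the pair z,
  -- o, which need not be adjacent.
  have hex : ∀ u v, ∃ n : ℕ, (n : ℕ∞) = min (G.edist u v) ((R + 1 : ℕ) : ℕ∞) := fun u v =>
    ENat.ne_top_iff_exists.1 (ne_top_of_le_ne_top (ENat.natCast_ne_top _) (min_le_right _ _))
  choose n hn using hex
  refine ⟨fun u v => n u v, fun v => ?_, fun u v => ?_, fun u v w => ?_, fun _ _ =>
    Nat.cast_nonneg _, fun u v h => ?_, fun u v => ?_, fun u v h => ?_, fun u v h => ?_⟩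
  · have : (n v v : ℕ∞) = 0 := by rw [hn, SimpleGraph.edist_self]; exact min_eq_left zero_le
    beta_reduce
    exact_mod_cast this
  · have : (n u v : ℕ∞) = n v u := by rw [hn, hn, SimpleGraph.edist_comm]
    beta_reduce
    exact_mod_cast this
  · have : (n u w : ℕ∞) ≤ n u v + n v w := by
      rw [hn, hn, hn]
      rcases le_total (G.edist u v) ((R + 1 : ℕ) : ℕ∞) with h1 | h1
      · rcases le_total (G.edist v w) ((R + 1 : ℕ) : ℕ∞) with h2 | h2
        · rw [min_eq_left h1, min_eq_left h2]
          exact (min_le_left _ _).trans SimpleGraph.edist_triangle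
        · rw [min_eq_right h2]
          exact (min_le_right _ _).trans le_add_self
      · rw [min_eq_right h1]
        exact (min_le_right _ _).trans le_self_add
    beta_reduce
    exact_mod_cast this
  · have : 0 < (n u v : ℕ∞) := by
      rw [hn]
      exact lt_min (SimpleGraph.edist_pos_of_ne h) (by simp)
    beta_reduce
    exact_mod_cast this
  · have : (n u v : ℕ∞) ≤ ((R + 1 : ℕ) : ℕ∞) := by rw [hn]; exact min_le_right _ _
    beta_reduce
    exact_mod_cast this
  · have : (n u v : ℕ∞) ≤ ((1 : ℕ) : ℕ∞) := by
      rw [hn, SimpleGraph.edist_eq_one_iff_adj.2 h]; exact min_le_left _ _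
    beta_reduce
    exact_mod_cast this
  · have : ((R + 1 : ℕ) : ℕ∞) ≤ n u v := by
      rw [hn]
      refine le_min ?_ le_rfl
      by_contra! hlt
      obtain ⟨w, hw⟩ := SimpleGraph.exists_walk_of_edist_ne_top hlt.ne_top
      rw [← hw] at hlt
      exact h ⟨w, by have : w.length < R + 1 := by exact_mod_cast hlt
                     omega⟩
    beta_reduce
    exact_mod_cast this

/-- The points of a hedgehog: a spine of the same length is attached to every vertex in `V`. -/
structure Hedgehog (V : Type) : Type u where
  vertex : V
  tip : Bool

open Classical in
/-- The distance of `x` and `y` along the spines. -/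
noncomputable def Hedgehog.spineDist {V : Type} (L : ℝ) (x y : Hedgehog.{u} V) : ℝ :=
  if x.vertex = y.vertex then (if x.tip = y.tip then 0 else L)
  else (if x.tip then L else 0) + (if y.tip then L else 0)

/-- The hedgehog over the metric `ρ` with spines of length `L`. -/
@[reducible] noncomputable def Hedgehog.metricSpace {V : Type} (ρ : V → V → ℝ) (h0 : ∀ v, ρ v v = 0)
    (hsymm : ∀ u v, ρ u v = ρ v u) (htri : ∀ u v w, ρ u w ≤ ρ u v + ρ v w)
    (hnn : ∀ u v, 0 ≤ ρ u v)
    (hpos : ∀ u v, u ≠ v → 0 < ρ u v) (L : ℝ) (hL : 0 < L) : MetricSpace (Hedgehog.{u} V) where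
  dist x y := ρ x.vertex y.vertex + x.spineDist L y
  dist_self x := by simp [h0, spineDist]
  dist_comm x y := by
    rw [hsymm]
    congr 1
    simp only [spineDist]
    grind
  dist_triangle x y z := by
    have h : x.spineDist L z ≤ x.spineDist L y + y.spineDist L z := by
      simp only [spineDist]
      grind
    linarith [htri x.vertex y.vertex z.vertex]
  eq_of_dist_eq_zero {x y} h := by
    have h2 : 0 ≤ x.spineDist L y := by
      simp only [spineDist]; split_ifs <;> linarith
    by_cases hv : x.vertex = y.vertex
    · have h3 : x.spineDist L y = 0 := by linarith [hnn x.vertex y.vertex]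
      simp only [spineDist, hv, if_true] at h3
      have ht : x.tip = y.tip := by
        by_contra hne
        rw [if_neg hne] at h3
        linarith
      cases x; cases y; simp_all
    · linarith [hpos _ _ hv]

/-! ### Compatibility graphs with prescribed pseudoarboricity -/

section LoadedGraph

variable {V : Type} [Fintype V] [LinearOrder V]

/-- Every edge of `H`, except `z o`, with multiplicity `M`, and the edge `z o` with
multiplicity `2 * r`. -/
noncomputable def loadedGraph (H : SimpleGraph V) (M r : ℕ) (z o : V) (hzo : z < o) :
    Multigraph V where
  Edge := (((orderedEdges H).erase (z, o) : Finset (V × V)) × Fin M) ⊕ (Fin r ⊕ Fin r)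
  fst := Sum.elim (fun e => e.1.1.1) fun _ => z
  snd := Sum.elim (fun e => e.1.1.2) fun _ => o
  loopless := by
    rintro (e | e)
    · exact (mem_orderedEdges.1 (Finset.mem_of_mem_erase e.1.2)).1.ne
    · exact hzo.ne

theorem sum_loadedGraph (H : SimpleGraph V) (M r : ℕ) (z o : V) (hzo : z < o) (f : V → V → ℝ) :
    ∑ e : (loadedGraph H M r z o hzo).Edge, f ((loadedGraph H M r z o hzo).fst e)
        ((loadedGraph H M r z o hzo).snd e) =
      M * ∑ x ∈ (orderedEdges H).erase (z, o), f x.1 x.2 + 2 * r * f z o := by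
  change ∑ e : (((orderedEdges H).erase (z, o) : Finset (V × V)) × Fin M) ⊕ (Fin r ⊕ Fin r), _ = _
  rw [Fintype.sum_sum_type, Fintype.sum_sum_type, Fintype.sum_prod_type]
  simp only [loadedGraph, Sum.elim_inl, Sum.elim_inr, Finset.sum_const, Finset.card_univ,
    Fintype.card_fin, nsmul_eq_mul]
  rw [← Finset.mul_sum, Finset.sum_coe_sort ((orderedEdges H).erase (z, o)) fun x => f x.1 x.2]
  ring

/-- The 2r parallel edges force out-degree at least r at z or o. Conversely, split them evenly and
orient every other edge so that its tail is neither z nor o; every other vertex is then the tail of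
at most d M ≤ r edges. -/
theorem pseudoarboricity_loadedGraph {H : SimpleGraph V} {M d r : ℕ} {z o : V} (hzo : z < o)
    (hd : ∀ v, (H.neighborSet v).ncard ≤ d) (hM : d * M ≤ r) :
    (loadedGraph H M r z o hzo).pseudoarboricity = r := by
  classical
  have hcard : ∀ (tail : (loadedGraph H M r z o hzo).Edge → V)
      (t₁ : ((orderedEdges H).erase (z, o) : Finset (V × V)) × Fin M → V) (t₂ t₃ : Fin r → V)
      (v : V), (∀ e, tail (Sum.inl e) = t₁ e) → (∀ i, tail (Sum.inr (Sum.inl i)) = t₂ i) →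
      (∀ i, tail (Sum.inr (Sum.inr i)) = t₃ i) →
      Nat.card {e // tail e = v} = (∑ e, if t₁ e = v then 1 else 0) +
        ((∑ i, if t₂ i = v then 1 else 0) + ∑ i, if t₃ i = v then 1 else 0) := by
    intro tail t₁ t₂ t₃ v h₁ h₂ h₃
    rw [Nat.card_eq_fintype_card, Fintype.card_subtype, Finset.card_filter]
    change ∑ e : (((orderedEdges H).erase (z, o) : Finset (V × V)) × Fin M) ⊕
      (Fin r ⊕ Fin r), _ = _
    rw [Fintype.sum_sum_type, Fintype.sum_sum_type]
    simp only [h₁, h₂, h₃]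
  refine le_antisymm (Nat.sInf_le ?_) ?_
  · refine ⟨Sum.elim (fun e => if e.1.1.1 = z ∨ e.1.1.1 = o then e.1.1.2 else e.1.1.1)
      (Sum.elim (fun _ => z) fun _ => o), ?_, fun v => ?_⟩
    · rintro (e | e | e)
      · simp only [loadedGraph, Sum.elim_inl]
        split_ifs <;> simp
      · exact Or.inl rfl
      · exact Or.inr rfl
    · refine (hcard _ (fun e => if e.1.1.1 = z ∨ e.1.1.1 = o then e.1.1.2 else e.1.1.1)
        (fun _ => z) (fun _ => o) v (fun _ => rfl) (fun _ => rfl) fun _ => rfl).trans_le ?_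
      simp only [Finset.sum_const, Finset.card_univ,
        Fintype.card_fin, smul_eq_mul]
      have hne : ∀ e : ((orderedEdges H).erase (z, o) : Finset (V × V)) × Fin M, ∀ v,
          (if e.1.1.1 = z ∨ e.1.1.1 = o then e.1.1.2 else e.1.1.1) = v →
          v ≠ z ∧ v ≠ o ∧ (e.1.1.1 = v ∨ e.1.1.2 = v) := by
        rintro ⟨⟨⟨a, b⟩, hab⟩, i⟩ v hv
        have h1 := Finset.ne_of_mem_erase hab
        have h2 := (mem_orderedEdges.1 (Finset.mem_of_mem_erase hab)).1
        simp only [ne_eq, Prod.mk.injEq, not_and] at h1 h2 hv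
        split_ifs at hv with h
        · subst hv
          refine ⟨?_, ?_, Or.inr rfl⟩ <;> rintro rfl <;> rcases h with rfl | rfl
          · exact lt_irrefl _ h2
          · exact lt_asymm h2 hzo
          · exact h1 rfl rfl
          · exact lt_irrefl _ h2
        · subst hv
          exact ⟨fun h' => h (Or.inl h'), fun h' => h (Or.inr h'), Or.inl rfl⟩
      by_cases hz : v = z
      · subst hz
        rw [Finset.sum_eq_zero fun e _ => if_neg fun h => (hne e _ h).1 rfl]
        simp [hzo.ne']
      by_cases ho : v = o
      · subst ho
        rw [Finset.sum_eq_zero fun e _ => if_neg fun h => (hne e _ h).2.1 rfl]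
        simp [hzo.ne]
      rw [if_neg (Ne.symm hz), if_neg (Ne.symm ho), mul_zero, add_zero, add_zero]
      calc _ ≤ ∑ e : ((orderedEdges H).erase (z, o) : Finset (V × V)) × Fin M,
            (if e.1.1.1 = v ∨ e.1.1.2 = v then 1 else 0) := by
            refine Finset.sum_le_sum fun e _ => ?_
            by_cases h : (if e.1.1.1 = z ∨ e.1.1.1 = o then e.1.1.2 else e.1.1.1) = v
            · rw [if_pos h, if_pos (hne e v h).2.2]
            · rw [if_neg h]; exact Nat.zero_le _
        _ = (∑ x ∈ (orderedEdges H).erase (z, o), if x.1 = v ∨ x.2 = v then 1 else 0) * M := by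
            rw [Fintype.sum_prod_type, 
              ← Finset.sum_coe_sort ((orderedEdges H).erase (z, o)), Finset.sum_mul]
            refine Finset.sum_congr rfl fun x _ => ?_
            by_cases h : x.1.1 = v ∨ x.1.2 = v <;> simp [h]
        _ ≤ d * M := by
            refine Nat.mul_le_mul_right _ ?_
            rw [← Finset.card_filter]
            exact (Finset.card_le_card (Finset.filter_subset_filter _
              (Finset.erase_subset _ _))).trans
              ((card_orderedEdges_incident_le H v).trans (hd v))
        _ ≤ r := hM
  · obtain ⟨tail, htail, hout⟩ :=
      (loadedGraph H M r z o hzo).hasOrientation_pseudoarboricity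
    have h1 := hout z
    have h2 := hout o
    rw [hcard tail _ _ _ _ (fun _ => rfl) (fun _ => rfl) fun _ => rfl] at h1 h2
    have h3 : ∀ i : Fin r ⊕ Fin r, 1 ≤ (if tail (Sum.inr i) = z then 1 else 0) +
        if tail (Sum.inr i) = o then 1 else 0 := fun i => by
      have : tail (Sum.inr i) = z ∨ tail (Sum.inr i) = o := htail (Sum.inr i)
      rcases this with h | h <;> simp [h]
    have h4 := Finset.sum_le_sum fun i (_ : i ∈ Finset.univ) => h3 (Sum.inl i)
    have h5 := Finset.sum_le_sum fun i (_ : i ∈ Finset.univ) => h3 (Sum.inr i)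
    rw [Finset.sum_add_distrib] at h4 h5
    simp only [Finset.sum_const, Finset.card_univ, Fintype.card_fin, smul_eq_mul, mul_one]
      at h4 h5
    omega

end LoadedGraph

/-! ### Instances with large pruning gap -/

/-- If there is a single data point the algorithm is optimal. -/
theorem exists_instance_one_le_pruningGap {k : ℕ} (hk : 0 < k) (G : Multigraph (Fin k)) :
    ∃ (X : Type u) (_ : MetricSpace X) (I : SNNInstance X k), Function.Injective I.q ∧ I.G = G ∧
      ∀ nn : Fin k → X, I.IsNearest nn → 1 ≤ I.pruningGap nn := by
  let I : SNNInstance (ULift.{u} ℝ) k :=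
    { P := {0}
      finite_P := Set.finite_singleton _
      nonempty_P := Set.singleton_nonempty _
      -- The shift by 1 keeps the queries off the data point, so the optimum is positive and the gap
      -- is not 0/0.
      q := fun i => ⟨(i : ℝ) + 1⟩
      G := G }
  refine ⟨ULift.{u} ℝ, inferInstance, I, fun i j h => ?_, rfl, fun nn hnn => ?_⟩
  · have h' : (i : ℝ) + 1 = (j : ℝ) + 1 := congrArg ULift.down h
    exact Fin.ext (by exact_mod_cast add_right_cancel h')
  · have hnn0 : ∀ i, nn i = 0 := fun i => (hnn i).1
    have hpos : 0 < I.assignmentCost fun _ => 0 := by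
      refine add_pos_of_pos_of_nonneg (Finset.sum_pos (fun i _ => dist_pos.2 fun h => ?_)
        ⟨⟨0, hk⟩, Finset.mem_univ _⟩) (Finset.sum_nonneg fun _ _ => dist_nonneg)
      have h' : (0 : ℝ) = (i : ℝ) + 1 := congrArg ULift.down h
      have : (0 : ℝ) ≤ (i : ℝ) := Nat.cast_nonneg _
      linarith
    rw [← ENNReal.ofReal_one]
    refine I.le_pruningGap zero_le_one hpos (p := fun _ => 0) (fun _ => rfl) le_rfl
      fun p' hp' => ?_
    have : p' = fun _ => 0 := by
      funext i
      obtain ⟨j, hj⟩ := hp' i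
      rw [← hj, hnn0]
    rw [this, one_mul]

/-- The hedgehog instance: `hrR` makes moving beyond R expensive compared with r², and `hk` leaves
room for the girth 2R + 2. -/
theorem exists_instance_le_pruningGap {k r R : ℕ} (hr : 8 ≤ r) (hk : 4 * 9 ^ (2 * R + 2) ≤ k)
    (hrR : (r : ℝ) ^ 2 ≤ 8 * (R + 1)) :
    ∃ (X : Type u) (_ : MetricSpace X) (I : SNNInstance X k),
      Function.Injective I.q ∧ I.G.pseudoarboricity = r ∧
        ∀ nn : Fin k → X, I.IsNearest nn → ENNReal.ofReal (1 / 512 * r) ≤ I.pruningGap nn := by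
  classical
  obtain ⟨H, hH, hd, hlo, hhi⟩ := exists_locallyAcyclic_card_orderedEdges (V := Fin k)
    (g := 2 * R + 2) (by omega) (by simpa using hk)
  rw [Fintype.card_fin] at hlo hhi
  obtain ⟨ρ, h0, hsymm, htri, hnn, hpos, hmax, hadj, hfar⟩ := exists_truncated_dist H R
  have hRk : 2 * R + 2 < k := by
    have := Nat.lt_pow_self (n := 2 * R + 2) (show 1 < 9 by norm_num)
    omega
  have hrpos : (0 : ℝ) < r := by exact_mod_cast (by omega : 0 < r)
  have hRkR : (R : ℝ) + 1 ≤ k := by exact_mod_cast (by omega : R + 1 ≤ k)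
  have hkpos : (0 : ℝ) < k := by exact_mod_cast (by omega : 0 < k)
  let z : Fin k := ⟨0, by omega⟩
  let o : Fin k := ⟨1, by omega⟩
  have hzo : z < o := by simp [z, o, Fin.lt_def]
  set M := r / 8 with hM
  have hM1 : 8 * M ≤ r := Nat.mul_div_le r 8
  have hM2 : r ≤ 16 * M := by omega
  have hM1' : 8 * (M : ℝ) ≤ r := by exact_mod_cast hM1
  have hM2' : (r : ℝ) ≤ 16 * M := by exact_mod_cast hM2
  set A := (orderedEdges H).erase (z, o) with hA
  let _ : MetricSpace (Hedgehog.{u} (Fin k)) :=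
    Hedgehog.metricSpace ρ h0 hsymm htri hnn hpos r hrpos
  have hdist : ∀ x y : Hedgehog.{u} (Fin k),
      dist x y = ρ x.vertex y.vertex + x.spineDist r y := fun _ _ => rfl
  have : Finite (Hedgehog.{u} (Fin k)) := by
    refine Finite.of_injective (β := Fin k × Bool) (fun x => (x.vertex, x.tip)) ?_
    rintro ⟨a, b⟩ ⟨c, d⟩ h
    simpa using h
  let I : SNNInstance (Hedgehog.{u} (Fin k)) k :=
    { P := Set.univ
      finite_P := Set.finite_univ
      nonempty_P := ⟨⟨z, true⟩, trivial⟩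
      q := fun v => ⟨v, true⟩
      G := loadedGraph H M r z o hzo }
  refine ⟨Hedgehog.{u} (Fin k), inferInstance, I, fun v w h => congrArg Hedgehog.vertex h,
    pseudoarboricity_loadedGraph hzo hd hM1, fun nn hnear => ?_⟩
  have hnnq : ∀ v, nn v = ⟨v, true⟩ := fun v => by
    have := (hnear v).2 (I.q v) trivial
    rw [dist_self] at this
    exact (dist_le_zero.1 this).symm
  -- All labels at the feet of the spines: k r for the queries, at most 4 k M ≤ k r / 2 for the
  -- edges of H, and at most 2 r (R + 1) ≤ 2 r k for the bundle at z, o.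
  have hB : I.assignmentCost (fun v => ⟨v, false⟩) ≤ 4 * k * r := by
    have h1 : ∑ v : Fin k, dist (⟨v, false⟩ : Hedgehog.{u} (Fin k)) (I.q v) = k * r := by
      simp [hdist, h0, I, Hedgehog.spineDist]
    have h2 := sum_loadedGraph H M r z o hzo fun u v =>
      dist (⟨u, false⟩ : Hedgehog.{u} (Fin k)) ⟨v, false⟩
    have h3 : ∀ u v, dist (⟨u, false⟩ : Hedgehog.{u} (Fin k)) ⟨v, false⟩ = ρ u v := fun u v => by
      simp [hdist, Hedgehog.spineDist]
    simp only [h3] at h2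
    have h4 : ∑ x ∈ A, ρ x.1 x.2 ≤ 4 * k := by
      calc ∑ x ∈ A, ρ x.1 x.2 ≤ ∑ x ∈ A, (1 : ℝ) := Finset.sum_le_sum fun x hx =>
            hadj _ _ (mem_orderedEdges.1 (Finset.mem_of_mem_erase hx)).2
        _ = (A.card : ℝ) := by simp
        _ ≤ 4 * k := by exact_mod_cast (Finset.card_erase_le.trans hhi)
    have h5 := hmax z o
    simp only [SNNInstance.assignmentCost, h1, h3]
    change _ + ∑ e : (loadedGraph H M r z o hzo).Edge, ρ ((loadedGraph H M r z o hzo).fst e)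
      ((loadedGraph H M r z o hzo).snd e) ≤ _
    rw [h2]
    have h6 : (M : ℝ) * ∑ x ∈ A, ρ x.1 x.2 ≤ M * (4 * k) :=
      mul_le_mul_of_nonneg_left h4 (Nat.cast_nonneg _)
    have h7 : 2 * (r : ℝ) * ρ z o ≤ 2 * r * k :=
      mul_le_mul_of_nonneg_left (h5.trans hRkR) (by positivity)
    nlinarith [mul_le_mul_of_nonneg_right hM1' hkpos.le]
  refine I.le_pruningGap (by positivity) (by positivity) (p := fun v => ⟨v, false⟩)
    (fun _ => trivial) hB fun p' hp' => ?_
  have hf : ∀ v, ∃ w, p' v = ⟨w, true⟩ := fun v => by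
    obtain ⟨w, hw⟩ := hp' v
    exact ⟨w, by rw [← hw, hnnq]⟩
  choose f hf using hf
  have hE := sum_loadedGraph H M r z o hzo fun u v => dist (p' u) (p' v)
  have hQ : ∑ v, ρ v (f v) ≤ ∑ v, dist (p' v) (I.q v) := by
    refine Finset.sum_le_sum fun v _ => ?_
    rw [hf, hdist, hsymm]
    refine le_add_of_nonneg_right ?_
    simp only [Hedgehog.spineDist, I]
    split_ifs <;> positivity
  have hcost : I.assignmentCost p' = ∑ v, dist (p' v) (I.q v) +
      (M * ∑ x ∈ A, dist (p' x.1) (p' x.2) + 2 * r * dist (p' z) (p' o)) := by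
    rw [← hE]; rfl
  have hC : ((A.filter fun x => f x.1 ≠ f x.2).card : ℝ) * (2 * r) ≤
      ∑ x ∈ A, dist (p' x.1) (p' x.2) := by
    rw [← nsmul_eq_mul, ← Finset.sum_const, Finset.sum_filter]
    refine Finset.sum_le_sum fun x _ => ?_
    split_ifs with h
    · rw [hf, hf, hdist]
      simp only [Hedgehog.spineDist, if_neg h, if_true]
      linarith [hnn (f x.1) (f x.2)]
    · exact dist_nonneg
  rw [hcost]
  have hlast : 0 ≤ 2 * (r : ℝ) * dist (p' z) (p' o) := by positivity
  have hQ0 : 0 ≤ ∑ v, dist (p' v) (I.q v) := Finset.sum_nonneg fun _ _ => dist_nonneg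
  have hE0 : 0 ≤ ∑ x ∈ A, dist (p' x.1) (p' x.2) := Finset.sum_nonneg fun _ _ => dist_nonneg
  have hME0 : 0 ≤ M * ∑ x ∈ A, dist (p' x.1) (p' x.2) := by positivity
  let B : Finset (Fin k) := Finset.univ.filter fun v => ¬ ∃ w : H.Walk v (f v), w.length ≤ R
  -- The target is (r / 512) · 4 k r = k r² / 128. Many far moves cost at least (k / 16)(R + 1),
  -- which suffices; otherwise k cut edges cost at least 2 k r M ≥ k r² / 8.
  by_cases hbad : k ≤ 16 * B.card
  · have h1 : (B.card : ℝ) * (R + 1) ≤ ∑ v, ρ v (f v) := by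
      rw [← nsmul_eq_mul, ← Finset.sum_const, Finset.sum_filter]
      refine Finset.sum_le_sum fun v _ => ?_
      split_ifs with h
      · exact hnn _ _
      · exact hfar _ _ h
    have h2 : (k : ℝ) ≤ 16 * B.card := by exact_mod_cast hbad
    have h3 : (k : ℝ) * (R + 1) ≤ 16 * B.card * (R + 1) :=
      mul_le_mul_of_nonneg_right h2 (by positivity)
    have h4 : (k : ℝ) * r ^ 2 ≤ k * (8 * (R + 1)) := mul_le_mul_of_nonneg_left hrR hkpos.le
    nlinarith
  · have h1 := hH.card_orderedEdges_le hd f B fun v hv => by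
      simpa [B] using hv
    rw [Fintype.card_fin] at h1
    have h2 : ((orderedEdges H).filter fun x => f x.1 ≠ f x.2).card ≤
        (A.filter fun x => f x.1 ≠ f x.2).card + 1 := by
      rw [hA, Finset.filter_erase]
      exact Nat.sub_le_iff_le_add.1 Finset.pred_card_le_card_erase
    -- Of at least 3k edges, at most k are uncut with both ends good and fewer than k / 2 meet B;
    -- one further edge is lost by erasing (z, o).
    have h3 : k ≤ (A.filter fun x => f x.1 ≠ f x.2).card := by omega
    have h3' : (k : ℝ) ≤ ((A.filter fun x => f x.1 ≠ f x.2).card : ℝ) := by exact_mod_cast h3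
    have h4 : (k : ℝ) * (2 * r) ≤ ∑ x ∈ A, dist (p' x.1) (p' x.2) :=
      (mul_le_mul_of_nonneg_right h3' (by positivity)).trans hC
    have h5 : (M : ℝ) * (k * (2 * r)) ≤ M * ∑ x ∈ A, dist (p' x.1) (p' x.2) :=
      mul_le_mul_of_nonneg_left h4 (Nat.cast_nonneg _)
    have h6 : (r : ℝ) * (k * r) ≤ 16 * M * (k * r) :=
      mul_le_mul_of_nonneg_right hM2' (by positivity)
    nlinarith

theorem exists_instance_pseudoarboricity (k r : ℕ) (hrk : (r : ℝ) ≤ Real.sqrt (Real.log k)) :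
    ∃ (X : Type u) (_ : MetricSpace X) (I : SNNInstance X k),
      Function.Injective I.q ∧ I.G.pseudoarboricity = r ∧
        ∀ nn : Fin k → X, I.IsNearest nn → ENNReal.ofReal (1 / 512 * r) ≤ I.pruningGap nn := by
  rcases lt_or_ge k 2 with hk | hk
  · have hr : r = 0 := by
      have h0 : Real.log k = 0 := by interval_cases k <;> simp
      rw [h0, Real.sqrt_zero] at hrk
      exact_mod_cast le_antisymm hrk (Nat.cast_nonneg _)
    subst hr
    let G : Multigraph (Fin k) := ⟨Empty, nofun, nofun, nofun⟩
    have hG : G.pseudoarboricity = 0 :=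
      Nat.le_zero.1 (Nat.sInf_le ⟨nofun, nofun, fun v => by
        have : IsEmpty {e : G.Edge // (nofun : Empty → Fin k) e = v} := ⟨fun e => nomatch e.1⟩
        simp⟩)
    rcases Nat.eq_zero_or_pos k with rfl | hk0
    · exact ⟨PUnit, inferInstance, ⟨Set.univ, Set.finite_univ, ⟨⟨⟩, trivial⟩, fun _ => ⟨⟩, G⟩,
        fun i => i.elim0, hG, fun _ _ => by simp⟩
    · obtain ⟨X, m, I, hq, hIG, -⟩ := exists_instance_one_le_pruningGap.{u} hk0 G
      exact ⟨X, m, I, hq, hIG ▸ hG, fun _ _ => by simp⟩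
  rcases lt_or_ge r 8 with hr | hr
  · have hzo : (⟨0, by omega⟩ : Fin k) < ⟨1, by omega⟩ := by simp [Fin.lt_def]
    obtain ⟨X, m, I, hq, hG, h⟩ := exists_instance_one_le_pruningGap.{u} (k := k) (by omega)
      (loadedGraph ⊥ 0 r _ _ hzo)
    refine ⟨X, m, I, hq, ?_, fun nn hnn => le_trans ?_ (h nn hnn)⟩
    · rw [hG]
      exact pseudoarboricity_loadedGraph (d := 0) hzo (fun v => by
        simp [SimpleGraph.neighborSet]) (by omega)
    · rw [ENNReal.ofReal_le_one]
      have : (r : ℝ) < 8 := by exact_mod_cast hr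
      linarith
  · have h64 : (r : ℝ) ^ 2 ≤ Real.log k := by
      have hlog : 0 ≤ Real.log k := Real.log_natCast_nonneg k
      calc (r : ℝ) ^ 2 ≤ Real.sqrt (Real.log k) ^ 2 := by gcongr
        _ = Real.log k := Real.sq_sqrt hlog
    have hr' : (8 : ℝ) ≤ r := by exact_mod_cast hr
    have hlog : 64 ≤ Real.log k := by nlinarith
    -- This gives r² ≤ log k < 8 (R + 1), while 4 · 9^(2R + 2) ≤ exp (10 + 5R) ≤ k because log k ≥
    -- 64.
    set R := ⌊Real.log k / 8⌋₊ with hR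
    have hR1 : (R : ℝ) ≤ Real.log k / 8 := Nat.floor_le (by positivity)
    have hR2 : Real.log k / 8 < R + 1 := Nat.lt_floor_add_one _
    refine exists_instance_le_pruningGap hr ?_ (by linarith)
    have hk0 : (0 : ℝ) < k := by exact_mod_cast (by omega : 0 < k)
    have : (4 * 9 ^ (2 * R + 2) : ℝ) ≤ k := by
      have he : (81 : ℝ) ≤ Real.exp 5 := by
        have h1 : (2.7 : ℝ) ≤ Real.exp 1 := by linarith [Real.exp_one_gt_d9]
        have h2 : Real.exp 5 = Real.exp 1 ^ 5 := by rw [← Real.exp_nat_mul]; norm_num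
        rw [h2]
        calc (81 : ℝ) ≤ 2.7 ^ 5 := by norm_num
          _ ≤ _ := by gcongr
      calc (4 * 9 ^ (2 * R + 2) : ℝ) = 4 * 81 * 81 ^ R := by
            rw [pow_add, pow_mul]; norm_num; ring
        _ ≤ 81 * 81 * 81 ^ R := by gcongr; norm_num
        _ ≤ Real.exp 5 * Real.exp 5 * Real.exp 5 ^ R := by gcongr
        _ = Real.exp (10 + R * 5) := by
            rw [← Real.exp_nat_mul, ← Real.exp_add, ← Real.exp_add]; norm_num
        _ ≤ Real.exp (Real.log k) := Real.exp_le_exp.2 (by linarith)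
        _ = k := Real.exp_log hk0
    exact_mod_cast this

theorem exists_instance_sqrt_log (k : ℕ) :
    ∃ (X : Type u) (_ : MetricSpace X) (I : SNNInstance X k),
      Function.Injective I.q ∧
        ∀ nn : Fin k → X, I.IsNearest nn →
          ENNReal.ofReal (1 / 1024 * Real.sqrt (Real.log k)) ≤ I.pruningGap nn := by
  rcases lt_or_ge (Real.sqrt (Real.log k)) 1 with h | h
  · rcases Nat.eq_zero_or_pos k with rfl | hk
    · obtain ⟨X, m, I, hq, -, -⟩ := exists_instance_pseudoarboricity.{u} 0 0 (by simp)
      exact ⟨X, m, I, hq, fun _ _ => by simp⟩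
    · obtain ⟨X, m, I, hq, -, hgap⟩ := exists_instance_one_le_pruningGap.{u} hk
        ⟨Empty, nofun, nofun, nofun⟩
      refine ⟨X, m, I, hq, fun nn hnn => le_trans ?_ (hgap nn hnn)⟩
      rw [ENNReal.ofReal_le_one]
      linarith
  -- Rounding a number that is at least 1 down to an integer loses at most a factor 2, hence 1/1024
  -- in place of 1/512.
  · obtain ⟨X, m, I, hq, -, hgap⟩ := exists_instance_pseudoarboricity.{u} k
      ⌊Real.sqrt (Real.log k)⌋₊ (Nat.floor_le (Real.sqrt_nonneg _))
    refine ⟨X, m, I, hq, fun nn hnn => le_trans (ENNReal.ofReal_le_ofReal ?_) (hgap nn hnn)⟩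
    have h1 := Nat.lt_floor_add_one (Real.sqrt (Real.log k))
    have h2 : (1 : ℝ) ≤ ⌊Real.sqrt (Real.log k)⌋₊ := by
      exact_mod_cast (Nat.one_le_floor_iff _).2 h
    linarith

/-! ### Averaging over shifts, radii and orders -/

open MeasureTheory in
theorem integral_floor_add (a : ℝ) : ∫ t in (0 : ℝ)..1, (⌊a + t⌋ : ℝ) = a := by
  have hint : ∀ b : ℝ, IntervalIntegrable (fun t => (⌊b + t⌋ : ℝ)) volume 0 1 := fun b =>
    Monotone.intervalIntegrable fun s t h => by
      exact_mod_cast Int.floor_mono (by linarith)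
  have hper : Function.Periodic (Int.fract : ℝ → ℝ) 1 := fun x => Int.fract_add_one x
  have h1 : ∫ t in (0 : ℝ)..1, Int.fract (a + t) = 1 / 2 := by
    rw [intervalIntegral.integral_comp_add_left (fun t => Int.fract t) a]
    have := hper.intervalIntegral_add_eq (a + 0) 0
    rw [add_zero, zero_add] at this
    rw [add_zero]
    rw [this, intervalIntegral.integral_of_le zero_le_one, integral_Ioc_eq_integral_Ioo,
      setIntegral_congr_fun (g := fun t => t) measurableSet_Ioo
        (fun t ht => Int.fract_eq_self.2 ⟨ht.1.le, ht.2⟩), ← integral_Ioc_eq_integral_Ioo,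
      ← intervalIntegral.integral_of_le zero_le_one, integral_id]
    norm_num
  have h2 : ∫ t in (0 : ℝ)..1, Int.fract (a + t) =
      (∫ t in (0 : ℝ)..1, (a + t)) - ∫ t in (0 : ℝ)..1, (⌊a + t⌋ : ℝ) := by
    rw [← intervalIntegral.integral_sub (f := fun t => a + t)
      (Continuous.intervalIntegrable (by fun_prop) 0 1) (hint a)]
    rfl
  have h3 : ∫ t in (0 : ℝ)..1, (a + t) = a + 1 / 2 := by
    rw [intervalIntegral.integral_add (g := fun t => t) intervalIntegrable_const
      (continuous_id.intervalIntegrable 0 1), integral_id]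
    simp
  linarith

open MeasureTheory in
/-- A random shift separates two reals by an integer with probability at most their distance. -/
theorem exists_shift {ι : Type*} (E : Finset ι) (w a b : ι → ℝ) (hw : ∀ e ∈ E, 0 ≤ w e) :
    ∃ θ : ℝ, 0 ≤ θ ∧ θ ≤ 1 ∧
      ∑ e ∈ E, (if ⌊a e + θ⌋ = ⌊b e + θ⌋ then 0 else w e) ≤ ∑ e ∈ E, w e * |a e - b e| := by
  have hint : ∀ b : ℝ, IntervalIntegrable (fun t => (⌊b + t⌋ : ℝ)) volume 0 1 := fun b =>
    Monotone.intervalIntegrable fun s t h => by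
      exact_mod_cast Int.floor_mono (by linarith)
  -- The floors differ by an integer, so the indicator of their being distinct is at most this
  -- absolute difference, whose mean is exact.
  have habs : ∀ a b : ℝ, ∫ t in (0 : ℝ)..1, |(⌊a + t⌋ : ℝ) - ⌊b + t⌋| = |a - b| := by
    have key : ∀ a b : ℝ, b ≤ a → ∫ t in (0 : ℝ)..1, |(⌊a + t⌋ : ℝ) - ⌊b + t⌋| = |a - b| := by
      intro a b hab
      have : ∀ t : ℝ, |(⌊a + t⌋ : ℝ) - ⌊b + t⌋| = (⌊a + t⌋ : ℝ) - ⌊b + t⌋ := fun t =>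
        abs_of_nonneg (sub_nonneg.2 (by exact_mod_cast Int.floor_mono (by linarith)))
      simp only [this]
      rw [intervalIntegral.integral_sub (hint a) (hint b), integral_floor_add, integral_floor_add,
        abs_of_nonneg (sub_nonneg.2 hab)]
    intro a b
    rcases le_total b a with h | h
    · exact key a b h
    · rw [abs_sub_comm a b, ← key b a h]
      simp only [abs_sub_comm]
  let F : ℝ → ℝ := fun t => ∑ e ∈ E, w e * |(⌊a e + t⌋ : ℝ) - ⌊b e + t⌋|
  have hFi : ∀ e ∈ E, IntervalIntegrable (fun t => w e * |(⌊a e + t⌋ : ℝ) - ⌊b e + t⌋|)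
      volume 0 1 := fun e _ => (((hint (a e)).sub (hint (b e))).abs).const_mul _
  have hF : ∫ t in (0 : ℝ)..1, F t = ∑ e ∈ E, w e * |a e - b e| := by
    rw [intervalIntegral.integral_finsetSum hFi]
    simp [habs]
  have hFint : IntegrableOn F (Set.Ioc 0 1) volume :=
    (intervalIntegrable_iff_integrableOn_Ioc_of_le zero_le_one).1
      (by
        simpa only [F, Finset.sum_fn] using IntervalIntegrable.sum E hFi)
  obtain ⟨θ, hθ, hle⟩ := exists_le_setAverage (by simp) (by simp) hFint
  refine ⟨θ, hθ.1.le, hθ.2, ?_⟩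
  rw [setAverage_eq, ← intervalIntegral.integral_of_le zero_le_one, hF] at hle
  simp only [Real.volume_real_Ioc, sub_zero, max_eq_left zero_le_one, inv_one, one_smul] at hle
  refine le_trans (Finset.sum_le_sum fun e he => ?_) hle
  split_ifs with h
  · exact mul_nonneg (hw e he) (abs_nonneg _)
  · refine le_mul_of_one_le_right (hw e he) ?_
    rw [← Int.cast_sub, ← Int.cast_abs]
    exact_mod_cast Int.one_le_abs (sub_ne_zero.2 h)

open MeasureTheory in
/-- A random radius in an interval falls into short intervals with small probability. -/
theorem exists_radius {ι : Type*} (E : Finset ι) (w α β : ι → ℝ) (hw : ∀ e ∈ E, 0 ≤ w e)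
    (hαβ : ∀ e ∈ E, α e ≤ β e) {A B : ℝ} (hAB : A < B) :
    ∃ R : ℝ, A < R ∧ R ≤ B ∧
      ∑ e ∈ E, (if α e ≤ R ∧ R < β e then w e else 0) ≤
        (B - A)⁻¹ * ∑ e ∈ E, w e * (β e - α e) := by
  let F : ℝ → ℝ := fun t => ∑ e ∈ E, (Set.Ico (α e) (β e)).indicator (fun _ => w e) t
  have hFi : ∀ e ∈ E, IntegrableOn ((Set.Ico (α e) (β e)).indicator fun _ => w e)
      (Set.Ioc A B) volume := fun e _ =>
    (integrableOn_const (by simp)).indicator measurableSet_Ico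
  have hF : ∫ t in Set.Ioc A B, F t ≤ ∑ e ∈ E, w e * (β e - α e) := by
    rw [integral_finsetSum _ hFi]
    refine Finset.sum_le_sum fun e he => ?_
    rw [setIntegral_indicator measurableSet_Ico, setIntegral_const, smul_eq_mul, mul_comm]
    refine mul_le_mul_of_nonneg_left ?_ (hw e he)
    calc _ ≤ volume.real (Set.Ico (α e) (β e)) :=
          measureReal_mono Set.inter_subset_right (by simp)
      _ = β e - α e := by
          rw [Real.volume_real_Ico, max_eq_left (sub_nonneg.2 (hαβ e he))]
  obtain ⟨R, hR, hle⟩ := exists_le_setAverage (by simpa using hAB) (by simp)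
    (f := F) (integrable_finsetSum _ hFi)
  refine ⟨R, hR.1, hR.2, ?_⟩
  rw [setAverage_eq, Real.volume_real_Ioc, max_eq_left (sub_nonneg.2 hAB.le), smul_eq_mul] at hle
  have h1 : ∑ e ∈ E, (if α e ≤ R ∧ R < β e then w e else 0) = F R := by
    refine Finset.sum_congr rfl fun e _ => ?_
    simp [Set.indicator_apply]
  rw [h1]
  exact hle.trans (mul_le_mul_of_nonneg_left hF (inv_nonneg.2 (sub_nonneg.2 hAB.le)))

/-- A given element of `S` comes first in a random order with probability `1 / #S`. -/
theorem card_perm_first_mul_card_le {k : ℕ} (S : Finset (Fin k)) {v : Fin k} (hv : v ∈ S) :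
    (Finset.univ.filter fun σ : Equiv.Perm (Fin k) => ∀ w ∈ S, σ v ≤ σ w).card * S.card ≤
      Fintype.card (Equiv.Perm (Fin k)) := by
  classical
  let N : Fin k → Finset (Equiv.Perm (Fin k)) := fun v =>
    Finset.univ.filter fun σ => ∀ w ∈ S, σ v ≤ σ w
  -- Exchanging v and u injects the orders with v first into those with u first, and these sets of
  -- orders are disjoint for distinct elements.
  have hN : ∀ u ∈ S, (N v).card ≤ (N u).card := by
    intro u hu
    refine Finset.card_le_card_of_injOn (fun σ => σ * Equiv.swap v u) ?_
      (fun σ _ τ _ h => mul_right_cancel h)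
    intro σ hσ
    simp only [N, Finset.coe_filter, Finset.mem_univ, true_and, Set.mem_ofPred_eq] at hσ ⊢
    intro w hw
    simp only [Equiv.Perm.mul_apply, Equiv.swap_apply_right]
    refine hσ _ ?_
    rw [Equiv.swap_apply_def]
    split_ifs <;> assumption
  have hdisj : (S : Set (Fin k)).PairwiseDisjoint N := by
    intro u hu w hw huw
    refine Finset.disjoint_left.2 fun σ h1 h2 => huw ?_
    simp only [N, Finset.mem_filter, Finset.mem_univ, true_and] at h1 h2
    exact σ.injective (le_antisymm (h1 w hw) (h2 u hu))
  calc (N v).card * S.card = ∑ u ∈ S, (N v).card := by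
        rw [Finset.sum_const, smul_eq_mul, mul_comm]
    _ ≤ ∑ u ∈ S, (N u).card := Finset.sum_le_sum hN
    _ = (S.biUnion N).card := (Finset.card_biUnion hdisj).symm
    _ ≤ _ := Finset.card_le_univ _

/-- Summing the inverses of the ranks. -/
theorem sum_inv_rank_le {V : Type*} [Fintype V] (μ : V → ℝ) {a b : ℝ}
    (ha : ∃ v, μ v ≤ a) (hab : a ≤ b) :
    ∑ w with a < μ w ∧ μ w ≤ b, ((Finset.univ.filter fun v => μ v ≤ μ w).card : ℝ)⁻¹ ≤
      Real.log (Finset.univ.filter fun v => μ v ≤ b).card -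
        Real.log (Finset.univ.filter fun v => μ v ≤ a).card := by
  classical
  set A := Finset.univ.filter fun v => μ v ≤ a with hA
  have hApos : 0 < A.card := by
    obtain ⟨v, hv⟩ := ha
    exact Finset.card_pos.2 ⟨v, by simp [hA, hv]⟩
  have key : ∀ Q : Finset V, (∀ w ∈ Q, a < μ w) →
      ∑ w ∈ Q, ((Finset.univ.filter fun v => μ v ≤ μ w).card : ℝ)⁻¹ ≤
        Real.log ((A.card + Q.card : ℕ) : ℝ) - Real.log A.card := by
    intro Q
    induction Q using Finset.induction_on_max_value μ with
    | empty => simp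
    | insert w Q hw hmax ih =>
      intro hQ
      have ih' := ih fun v hv => hQ v (Finset.mem_insert_of_mem hv)
      rw [Finset.sum_insert hw, Finset.card_insert_of_notMem hw]
      set n : ℕ := A.card + Q.card with hn
      have hn0 : (0 : ℝ) < n := by exact_mod_cast (by omega : 0 < n)
      have hdisj : Disjoint A (insert w Q) := by
        refine Finset.disjoint_left.2 fun v hv hv' => ?_
        simp only [hA, Finset.mem_filter, Finset.mem_univ, true_and] at hv
        exact absurd (hQ v hv') hv.not_gt
      -- All of A and Q come no later than the maximal w, so its inverse rank is at most 1 / (n + 1)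
      -- ≤ log ((n + 1) / n), and these logarithms telescope.
      have hrank : n + 1 ≤ (Finset.univ.filter fun v => μ v ≤ μ w).card := by
        have : (A ∪ insert w Q).card = n + 1 := by
          rw [Finset.card_union_of_disjoint hdisj, Finset.card_insert_of_notMem hw, hn, add_assoc]
        rw [← this]
        refine Finset.card_le_card fun v hv => ?_
        simp only [Finset.mem_filter, Finset.mem_univ, true_and]
        rcases Finset.mem_union.1 hv with h | h
        · simp only [hA, Finset.mem_filter, Finset.mem_univ, true_and] at h
          exact h.trans (hQ w (Finset.mem_insert_self _ _)).le
        · rcases Finset.mem_insert.1 h with rfl | h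
          · exact le_rfl
          · exact hmax v h
      have h1 : ((Finset.univ.filter fun v => μ v ≤ μ w).card : ℝ)⁻¹ ≤ ((n : ℝ) + 1)⁻¹ := by
        refine inv_anti₀ (by positivity) ?_
        exact_mod_cast hrank
      have h2 := Real.one_sub_inv_le_log_of_pos (x := ((n : ℝ) + 1) / n) (by positivity)
      rw [Real.log_div (by positivity) hn0.ne', inv_div] at h2
      have h3 : 1 - (n : ℝ) / (n + 1) = ((n : ℝ) + 1)⁻¹ := by field_simp; ring
      have h4 : ((A.card + (Q.card + 1) : ℕ) : ℝ) = (n : ℝ) + 1 := by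
        rw [hn]; push_cast; ring
      rw [h4]
      linarith
  have h := key (Finset.univ.filter fun w => a < μ w ∧ μ w ≤ b) fun w hw => by
    simp only [Finset.mem_filter, Finset.mem_univ, true_and] at hw
    exact hw.1
  rw [← Finset.card_union_of_disjoint] at h
  · convert! h using 5
    ext v
    simp only [hA, Finset.mem_filter, Finset.mem_univ, true_and, Finset.mem_union]
    constructor
    · intro hv
      rcases le_or_gt (μ v) a with h | h
      exacts [Or.inl h, Or.inr ⟨h, hv⟩]
    · rintro (h | h)
      exacts [h.trans hab, h.2]
  · refine Finset.disjoint_left.2 fun v hv hv' => ?_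
    simp only [hA, Finset.mem_filter, Finset.mem_univ, true_and] at hv hv'
    exact absurd hv'.1 hv.not_gt

/-! ### Low-cut partitions of finite sets of labels -/

section CKR

variable {X : Type u} [MetricSpace X] {k : ℕ}

/-- The logarithm of the number of points within distance `s` of `p u` or `p v`. -/
noncomputable def logGrowth (p : Fin k → X) (u v : Fin k) (s : ℝ) : ℝ :=
  Real.log (Finset.univ.filter fun w =>
    min (dist (p w) (p u)) (dist (p w) (p v)) ≤ s).card

/-- A partition into clusters of diameter at most `r` which cuts few pairs
(Călinescu, Karloff and Rabani). -/
theorem exists_partition_card_cut_le (p : Fin k → X) {r : ℝ} (hr : 0 < r) {ι : Type*}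
    (F : Finset ι) (x y : ι → Fin k) (hd : ∀ e ∈ F, dist (p (x e)) (p (y e)) ≤ r / 8) :
    ∃ S : Setoid (Fin k), (∀ u v, S u v → dist (p u) (p v) ≤ r) ∧
      ∑ e ∈ F, (open Classical in if S (x e) (y e) then (0 : ℝ) else 1) ≤
        ∑ e ∈ F, 4 * dist (p (x e)) (p (y e)) / r *
          (logGrowth p (x e) (y e) (r / 2) - logGrowth p (x e) (y e) (r / 8)) := by
  classical
  let μ : ι → Fin k → ℝ := fun e w => min (dist (p w) (p (x e))) (dist (p w) (p (y e)))
  let ν : ι → Fin k → ℝ := fun e w => max (dist (p w) (p (x e))) (dist (p w) (p (y e)))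
  let s : ι → Fin k → ℝ := fun e w => (Finset.univ.filter fun v => μ e v ≤ μ e w).card
  let J : ι → Finset (Fin k) := fun e => Finset.univ.filter fun w => r / 8 < μ e w ∧ μ e w ≤ r / 2
  have hspos : ∀ e w, 0 < s e w := fun e w => by
    simp only [s, Nat.cast_pos, Finset.card_pos]
    exact ⟨w, by simp⟩
  have hνμ : ∀ e w, ν e w - μ e w ≤ dist (p (x e)) (p (y e)) := fun e w => by
    have h1 := dist_triangle (p w) (p (x e)) (p (y e))
    have h2 := dist_triangle (p w) (p (y e)) (p (x e))
    rw [dist_comm (p (y e)) (p (x e))] at h2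
    simp only [μ, ν]
    rcases le_total (dist (p w) (p (x e))) (dist (p w) (p (y e))) with h | h
    · rw [max_eq_right h, min_eq_left h]; linarith
    · rw [max_eq_left h, min_eq_right h]; linarith
  -- The radius is fixed before the order. The weight 1 / rank already anticipates the chance that w
  -- comes first among the points at least as close to the edge.
  obtain ⟨R, hR1, hR2, hR⟩ := exists_radius (F.sigma J) (fun z => (s z.1 z.2)⁻¹)
    (fun z => μ z.1 z.2) (fun z => ν z.1 z.2) (fun z _ => (inv_pos.2 (hspos _ _)).le)
    (fun z _ => min_le_max) (show r / 4 < r / 2 by linarith)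
  rw [Finset.sum_sigma, Finset.sum_sigma] at hR
  have hball : ∀ (σ : Equiv.Perm (Fin k)) (v : Fin k), ∃ c, dist (p c) (p v) ≤ R ∧
      ∀ w, dist (p w) (p v) ≤ R → σ c ≤ σ w := by
    intro σ v
    obtain ⟨c, hc, hmin⟩ := Finset.exists_min_image
      (Finset.univ.filter fun w => dist (p w) (p v) ≤ R) σ ⟨v, by simp; linarith⟩
    exact ⟨c, by simpa using hc, fun w hw => hmin w (by simpa using hw)⟩
  choose c hcR hcmin using hball
  have hcut : ∀ (σ : Equiv.Perm (Fin k)), ∀ e ∈ F,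
      (if c σ (x e) = c σ (y e) then (0 : ℝ) else 1) ≤ ∑ w ∈ J e,
        if (μ e w ≤ R ∧ R < ν e w) ∧ (∀ v ∈ Finset.univ.filter (fun v => μ e v ≤ R), σ w ≤ σ v)
        then 1 else 0 := by
    intro σ e he
    split_ifs with hc
    · exact Finset.sum_nonneg fun w _ => by split_ifs <;> norm_num
    -- Each point joins the first center within R. If the two centers of an edge differ, the earlier
    -- one lies in exactly one of the two balls and is first in their union.
    have hm : ∃ m, μ e m ≤ R ∧ R < ν e m ∧
        ∀ v ∈ Finset.univ.filter (fun v => μ e v ≤ R), σ m ≤ σ v := by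
      rcases le_total (σ (c σ (x e))) (σ (c σ (y e))) with h | h
      · refine ⟨c σ (x e), min_le_of_left_le (hcR _ _), lt_max_of_lt_right ?_, fun v hv => ?_⟩
        · by_contra! hle
          exact hc (σ.injective (le_antisymm h (hcmin σ (y e) _ hle)))
        · simp only [Finset.mem_filter, Finset.mem_univ, true_and, μ, min_le_iff] at hv
          rcases hv with hv | hv
          exacts [hcmin _ _ _ hv, h.trans (hcmin _ _ _ hv)]
      · refine ⟨c σ (y e), min_le_of_right_le (hcR _ _), lt_max_of_lt_left ?_, fun v hv => ?_⟩
        · by_contra! hle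
          exact hc (σ.injective (le_antisymm (hcmin σ (x e) _ hle) h))
        · simp only [Finset.mem_filter, Finset.mem_univ, true_and, μ, min_le_iff] at hv
          rcases hv with hv | hv
          exacts [h.trans (hcmin _ _ _ hv), hcmin _ _ _ hv]
    obtain ⟨m, hm1, hm2, hm3⟩ := hm
    have hmJ : m ∈ J e := by
      -- The lower end of the window is ν - d > r / 4 - r / 8.
      simp only [J, Finset.mem_filter, Finset.mem_univ, true_and]
      exact ⟨by linarith [hνμ e m, hd e he], hm1.trans hR2⟩
    refine le_trans ?_ (Finset.single_le_sum (fun w _ => ?_) hmJ)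
    · rw [if_pos ⟨⟨hm1, hm2⟩, hm3⟩]
    · split_ifs <;> norm_num
  set T : ℝ := ∑ e ∈ F, ∑ w ∈ J e, if μ e w ≤ R ∧ R < ν e w then (s e w)⁻¹ else 0 with hT
  have havg : ∑ σ : Equiv.Perm (Fin k), ∑ e ∈ F,
      (if c σ (x e) = c σ (y e) then (0 : ℝ) else 1) ≤ ∑ σ : Equiv.Perm (Fin k), T := by
    calc _ ≤ ∑ σ : Equiv.Perm (Fin k), ∑ e ∈ F, ∑ w ∈ J e,
          (if (μ e w ≤ R ∧ R < ν e w) ∧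
            (∀ v ∈ Finset.univ.filter (fun v => μ e v ≤ R), σ w ≤ σ v) then (1 : ℝ) else 0) :=
          Finset.sum_le_sum fun σ _ => Finset.sum_le_sum fun e he => hcut σ e he
      _ = ∑ e ∈ F, ∑ w ∈ J e, ∑ σ : Equiv.Perm (Fin k),
          (if (μ e w ≤ R ∧ R < ν e w) ∧
            (∀ v ∈ Finset.univ.filter (fun v => μ e v ≤ R), σ w ≤ σ v) then (1 : ℝ) else 0) := by
          rw [Finset.sum_comm]
          exact Finset.sum_congr rfl fun e _ => Finset.sum_comm
      _ ≤ ∑ e ∈ F, ∑ w ∈ J e, (Fintype.card (Equiv.Perm (Fin k)) : ℝ) *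
          (if μ e w ≤ R ∧ R < ν e w then (s e w)⁻¹ else 0) := by
          refine Finset.sum_le_sum fun e _ => Finset.sum_le_sum fun w _ => ?_
          by_cases h : μ e w ≤ R ∧ R < ν e w
          · simp only [h, and_self, true_and, if_true]
            rw [Finset.sum_boole, ← div_eq_mul_inv, le_div_iff₀ (hspos e w)]
            have h1 := card_perm_first_mul_card_le (Finset.univ.filter fun v => μ e v ≤ R)
              (v := w) (by simp [h.1])
            have h2 : s e w ≤ ((Finset.univ.filter fun v => μ e v ≤ R).card : ℝ) := by
              simp only [s, Nat.cast_le]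
              refine Finset.card_le_card fun v hv => ?_
              simp only [Finset.mem_filter, Finset.mem_univ, true_and] at hv ⊢
              exact hv.trans h.1
            refine (mul_le_mul_of_nonneg_left h2 (Nat.cast_nonneg _)).trans ?_
            exact_mod_cast h1
          · simp [h]
      _ = ∑ σ : Equiv.Perm (Fin k), T := by
          rw [Finset.sum_const, Finset.card_univ, nsmul_eq_mul, hT, Finset.mul_sum]
          simp only [Finset.mul_sum]
  obtain ⟨σ, -, hσ⟩ := Finset.exists_le_of_sum_le Finset.univ_nonempty havg
  refine ⟨Setoid.ker (c σ), fun u v huv => ?_, ?_⟩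
  · have h1 := hcR σ u
    have h2 := hcR σ v
    rw [← show c σ u = c σ v from huv] at h2
    linarith [dist_triangle_left (p u) (p v) (p (c σ u))]
  refine (le_of_eq (Finset.sum_congr rfl fun e _ => ?_)).trans (hσ.trans (hR.trans ?_))
  · simp only [Setoid.ker_def]
  rw [Finset.mul_sum]
  refine Finset.sum_le_sum fun e he => ?_
  have h1 := sum_inv_rank_le (μ e) (a := r / 8) (b := r / 2)
    ⟨x e, by simp only [μ, dist_self]; exact (min_le_left _ _).trans (by positivity)⟩ (by linarith)
  have h2 : ∑ w ∈ J e, (s e w)⁻¹ * (ν e w - μ e w) ≤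
      dist (p (x e)) (p (y e)) * ∑ w ∈ J e, (s e w)⁻¹ := by
    rw [Finset.mul_sum]
    refine Finset.sum_le_sum fun w _ => ?_
    rw [mul_comm]
    exact mul_le_mul_of_nonneg_right (hνμ e w) (inv_pos.2 (hspos _ _)).le
  have h3 : (r / 2 - r / 4)⁻¹ = 4 / r := by field_simp; norm_num
  rw [h3]
  calc 4 / r * ∑ w ∈ J e, (s e w)⁻¹ * (ν e w - μ e w)
      ≤ 4 / r * (dist (p (x e)) (p (y e)) * ∑ w ∈ J e, (s e w)⁻¹) :=
        mul_le_mul_of_nonneg_left h2 (by positivity)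
    _ = 4 * dist (p (x e)) (p (y e)) / r * ∑ w ∈ J e, (s e w)⁻¹ := by ring
    _ ≤ _ := mul_le_mul_of_nonneg_left h1 (by positivity)

end CKR

/-! ### Rounding by scales and partitions -/

section Rounding

variable {X : Type u} [MetricSpace X] {k : ℕ}

/-- Rounding the labels `p` to terminals by means of a partition for every distance scale. -/
theorem exists_rounding {nn p : Fin k → X} {τ : Fin k → Fin k}
    (hτ : ∀ i j, dist (p i) (nn (τ i)) ≤ dist (p i) (nn j))
    {E : Type*} [Fintype E] (x y : E → Fin k) :
    ∃ (ℓ : Fin k → ℤ) (N : Finset E),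
      (∀ e ∈ N, dist (p (x e)) (p (y e)) ≤ Real.exp (ℓ (x e) + 1) / 2) ∧
      ∀ (j : ℝ) (S : ℤ → Setoid (Fin k)),
        (∀ n u v, S n u v → dist (p u) (p v) ≤ Real.exp (n + j)) →
        ∃ p' : Fin k → X, (∀ i, p' i ∈ Set.range nn) ∧
          ∑ i, dist (p' i) (p i) ≤
            (Real.exp 2 + Real.exp (j + 1)) * ∑ i, dist (p i) (nn (τ i)) ∧
          ∑ e, dist (p' (x e)) (p' (y e)) ≤
            12 * (Real.exp 2 + Real.exp (j + 1)) * ∑ e, dist (p (x e)) (p (y e)) +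
            3 * Real.exp 1 * (Real.exp 2 + Real.exp (j + 1)) *
              ∑ e ∈ N, Real.exp (ℓ (x e)) *
                (open Classical in if S (ℓ (x e)) (x e) (y e) then (0 : ℝ) else 1) := by
  classical
  set D : Fin k → ℝ := fun i => dist (p i) (nn (τ i)) with hD
  have hD0 : ∀ i, 0 ≤ D i := fun i => dist_nonneg
  have hLip : ∀ i j, D i ≤ D j + dist (p i) (p j) :=
    SNNInstance.dist_nearest_terminal_lipschitz hτ
  set d : E → ℝ := fun e => dist (p (x e)) (p (y e)) with hd
  have hd0 : ∀ e, 0 ≤ d e := fun e => dist_nonneg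
  have hxy : ∀ e, D (x e) ≤ D (y e) + d e := fun e => hLip _ _
  have hyx : ∀ e, D (y e) ≤ D (x e) + d e := fun e => by
    have := hLip (y e) (x e)
    rwa [dist_comm] at this
  -- Edges outside `near` have D = O(d) at both ends, so they can afford any move of size K D.
  let near : Finset E := Finset.univ.filter fun e => 0 < D (x e) ∧ d e ≤ D (x e) / 2
  have hnear : ∀ e, e ∈ near ↔ 0 < D (x e) ∧ d e ≤ D (x e) / 2 := fun e => by simp [near]
  obtain ⟨θ, hθ0, hθ1, hθ⟩ := exists_shift near (fun e => D (x e))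
    (fun e => Real.log (D (x e))) (fun e => Real.log (D (y e))) fun e _ => hD0 _
  set ℓ : Fin k → ℤ := fun v => ⌊Real.log (D v) + θ⌋ with hℓ
  have hlogdiff : ∀ a b : ℝ, 0 < a → 0 < b → Real.log a - Real.log b ≤ (a - b) / b := by
    intro a b ha hb
    rw [← Real.log_div ha.ne' hb.ne']
    refine (Real.log_le_sub_one_of_pos (by positivity)).trans_eq ?_
    field_simp
  -- A near edge separates levels with probability at most 2 d / D and then pays O(K D), hence O(K
  -- d) on average.
  have hshift : ∑ e ∈ near, (if ℓ (x e) = ℓ (y e) then 0 else D (x e)) ≤ 2 * ∑ e, d e := by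
    refine hθ.trans ?_
    rw [Finset.mul_sum]
    refine (Finset.sum_le_sum fun e he => ?_).trans
      (Finset.sum_le_sum_of_subset_of_nonneg (Finset.subset_univ near) fun e _ _ => by
        have := hd0 e; positivity)
    obtain ⟨hpos, hle⟩ := (hnear e).1 he
    have hy : D (x e) / 2 ≤ D (y e) := by linarith [hxy e]
    have hypos : 0 < D (y e) := by linarith
    have habs : |Real.log (D (x e)) - Real.log (D (y e))| ≤ d e / (D (x e) / 2) := by
      rw [abs_sub_le_iff]
      constructor
      · refine (hlogdiff _ _ hpos hypos).trans ?_
        exact div_le_div₀ (hd0 e) (by linarith [hxy e]) (by positivity) hy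
      · refine (hlogdiff _ _ hypos hpos).trans ?_
        exact div_le_div₀ (hd0 e) (by linarith [hyx e]) (by positivity) (by linarith)
    calc D (x e) * |Real.log (D (x e)) - Real.log (D (y e))|
        ≤ D (x e) * (d e / (D (x e) / 2)) := mul_le_mul_of_nonneg_left habs (hD0 _)
      _ = 2 * d e := by field_simp
  have hexp1 : ∀ v, 0 < D v → Real.exp (ℓ v) ≤ Real.exp 1 * D v := fun v hv => by
    calc Real.exp (ℓ v) ≤ Real.exp (1 + Real.log (D v)) := by
          refine Real.exp_le_exp.2 ?_
          have := Int.floor_le (Real.log (D v) + θ)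
          simp only [hℓ]
          linarith
      _ = Real.exp 1 * D v := by rw [Real.exp_add, Real.exp_log hv]
  have hexp2 : ∀ v, D v ≤ Real.exp (ℓ v + 1) := fun v => by
    rcases (hD0 v).eq_or_lt with h | h
    · rw [← h]; positivity
    · rw [← Real.log_le_iff_le_exp h]
      have := Int.lt_floor_add_one (Real.log (D v) + θ)
      simp only [hℓ]
      linarith
  refine ⟨ℓ, near.filter fun e => ℓ (x e) = ℓ (y e), fun e he => ?_,
    fun j S hS => ?_⟩
  · have h1 := ((hnear e).1 (Finset.mem_filter.1 he).1).2
    linarith [hexp2 (x e)]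
  set K := Real.exp 2 + Real.exp (j + 1) with hK
  have hK1 : 1 ≤ K := by
    have h1 : 1 ≤ Real.exp 2 := Real.one_le_exp (by norm_num)
    have h2 := Real.exp_pos (j + 1)
    linarith
  let Z : Setoid (Fin k) :=
    { r := fun u v => ℓ u = ℓ v ∧ S (ℓ u) u v
      iseqv := ⟨fun u => ⟨rfl, (S _).refl u⟩, fun {u v} h => ⟨h.1.symm, h.1 ▸ (S _).symm h.2⟩,
        fun {u v w} h h' => ⟨h.1.trans h'.1, (S _).trans h.2 (h.1 ▸ h'.2)⟩⟩ }
  let rep : Fin k → Fin k := fun v => (Quotient.mk Z v).out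
  have hrep : ∀ v, ℓ (rep v) = ℓ v ∧ S (ℓ (rep v)) (rep v) v := fun v =>
    Quotient.mk_out (s := Z) v
  -- With D v = 0 the level comes from `Real.log 0 = 0` and exp (ℓ v) is not O(D v), so such a label
  -- keeps its own terminal. It may still represent a cluster, since `hexp2` holds for it.
  let p' : Fin k → X := fun v => if D v = 0 then nn (τ v) else nn (τ (rep v))
  have hp' : ∀ v, dist (p' v) (p v) ≤ K * D v := by
    intro v
    by_cases hv : D v = 0
    · simp only [p', if_pos hv, dist_comm (nn (τ v)) (p v)]
      rw [hv, mul_zero]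
      exact hv.le
    · have hpos := (hD0 v).lt_of_ne' hv
      simp only [p', if_neg hv]
      have h1 := dist_triangle_left (nn (τ (rep v))) (p v) (p (rep v))
      have h2 := hS _ _ _ (hrep v).2
      have h3 := hexp2 (rep v)
      rw [(hrep v).1] at h2 h3
      rw [Real.exp_add] at h2 h3
      have h4 := hexp1 v hpos
      have h5 : K = Real.exp 1 * Real.exp 1 + Real.exp 1 * Real.exp j := by
        rw [hK, ← Real.exp_add, ← Real.exp_add]; norm_num [add_comm]
      have h6 := mul_le_mul_of_nonneg_right h4 (Real.exp_pos 1).le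
      have h7 := mul_le_mul_of_nonneg_right h4 (Real.exp_pos j).le
      have h8 : dist (p (rep v)) (nn (τ (rep v))) = D (rep v) := rfl
      rw [h5]
      linarith
  have hedge : ∀ e, dist (p' (x e)) (p' (y e)) ≤ 6 * K * d e + 3 * K *
      (if e ∈ near then (if ℓ (x e) = ℓ (y e) then 0 else D (x e)) +
        (if ℓ (x e) = ℓ (y e) then
          Real.exp 1 * (Real.exp (ℓ (x e)) * if S (ℓ (x e)) (x e) (y e) then 0 else 1) else 0)
        else 0) := by
    intro e
    have htri : dist (p' (x e)) (p' (y e)) ≤ K * D (x e) + d e + K * D (y e) := by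
      have h1 := dist_triangle4 (p' (x e)) (p (x e)) (p (y e)) (p' (y e))
      have h2 := hp' (x e)
      have h3 := hp' (y e)
      rw [dist_comm] at h3
      have h4 : dist (p (x e)) (p (y e)) = d e := rfl
      linarith
    have hKd : d e ≤ K * d e := le_mul_of_one_le_left (hd0 e) hK1
    by_cases he : e ∈ near
    · obtain ⟨hpos, hle⟩ := (hnear e).1 he
      have hypos : 0 < D (y e) := by linarith [hxy e]
      have hKD : K * d e ≤ K * (D (x e) / 2) := mul_le_mul_of_nonneg_left hle (by linarith)
      have hKy : K * D (y e) ≤ K * (D (x e) + d e) :=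
        mul_le_mul_of_nonneg_left (hyx e) (by linarith)
      -- A near edge has D (y e) ≤ (3/2) D (x e) and d e ≤ D (x e) / 2.
      have hcut : dist (p' (x e)) (p' (y e)) ≤ 3 * K * D (x e) := by nlinarith
      have hKd0 : 0 ≤ K * d e := (hd0 e).trans hKd
      rw [if_pos he]
      by_cases hl : ℓ (x e) = ℓ (y e)
      · rw [if_pos hl, if_pos hl]
        by_cases hs : S (ℓ (x e)) (x e) (y e)
        · have hr : rep (x e) = rep (y e) :=
            congrArg Quotient.out (Quotient.sound (s := Z) ⟨hl, hs⟩)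
          have : p' (x e) = p' (y e) := by
            simp only [p', if_neg hpos.ne', if_neg hypos.ne', hr]
          rw [if_pos hs, this, dist_self]
          linarith
        · rw [if_neg hs]
          have h1 := hexp2 (x e)
          rw [Real.exp_add] at h1
          have h2 : 3 * K * D (x e) ≤ 3 * K * (Real.exp (ℓ (x e)) * Real.exp 1) :=
            mul_le_mul_of_nonneg_left h1 (by linarith)
          linarith
      · rw [if_neg hl, if_neg hl]
        linarith
    · rw [if_neg he, mul_zero, add_zero]
      have hx2 : D (x e) ≤ 2 * d e := by
        by_contra! hlt
        exact he ((hnear e).2 ⟨by linarith [hd0 e], by linarith⟩)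
      have hy3 : D (y e) ≤ 3 * d e := by linarith [hyx e]
      have h1 : K * D (x e) ≤ K * (2 * d e) := mul_le_mul_of_nonneg_left hx2 (by linarith)
      have h2 : K * D (y e) ≤ K * (3 * d e) := mul_le_mul_of_nonneg_left hy3 (by linarith)
      linarith
  refine ⟨p', fun v => ?_, ?_, ?_⟩
  · simp only [p']
    split_ifs
    exacts [⟨_, rfl⟩, ⟨_, rfl⟩]
  · rw [Finset.mul_sum]
    exact Finset.sum_le_sum fun v _ => hp' v
  · refine (Finset.sum_le_sum fun e _ => hedge e).trans ?_
    rw [Finset.sum_add_distrib, ← Finset.mul_sum, ← Finset.mul_sum, ← Finset.sum_filter,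
      Finset.filter_univ_mem, Finset.sum_add_distrib, ← Finset.sum_filter _ (s := near),
      ← Finset.mul_sum]
    have : 3 * K * ∑ e ∈ near, (if ℓ (x e) = ℓ (y e) then 0 else D (x e)) ≤
        3 * K * (2 * ∑ e, d e) := mul_le_mul_of_nonneg_left hshift (by linarith)
    linarith

/-- Partitions for the different scales can be chosen independently. -/
theorem exists_partitions {E : Type*} (N : Finset E) (x y : E → Fin k) (n : E → ℤ)
    (Q : ℤ → Setoid (Fin k) → Prop) (β : ℤ → E → ℝ)
    (h : ∀ m, ∃ S, Q m S ∧
      ∑ e ∈ N with n e = m, (open Classical in if S (x e) (y e) then (0 : ℝ) else 1) ≤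
        ∑ e ∈ N with n e = m, β m e) :
    ∃ S : ℤ → Setoid (Fin k), (∀ m, Q m (S m)) ∧
      ∑ e ∈ N, Real.exp (n e) *
        (open Classical in if S (n e) (x e) (y e) then (0 : ℝ) else 1) ≤
        ∑ e ∈ N, Real.exp (n e) * β (n e) e := by
  classical
  choose S hS hle using h
  refine ⟨S, hS, ?_⟩
  have hmaps : ∀ e ∈ N, n e ∈ N.image n := fun e he => Finset.mem_image_of_mem n he
  rw [← Finset.sum_fiberwise_of_maps_to hmaps, ← Finset.sum_fiberwise_of_maps_to hmaps]
  refine Finset.sum_le_sum fun m _ => ?_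
  have h1 : ∀ f : ℤ → E → ℝ, ∑ e ∈ N with n e = m, Real.exp (n e) * f (n e) e =
      Real.exp m * ∑ e ∈ N with n e = m, f m e := fun f => by
    rw [Finset.mul_sum]
    refine Finset.sum_congr rfl fun e he => ?_
    rw [(Finset.mem_filter.1 he).2]
  rw [h1 fun m e => if S m (x e) (y e) then 0 else 1, h1 β]
  exact mul_le_mul_of_nonneg_left (hle m) (Real.exp_pos _).le

theorem SNNInstance.assignmentCost_rounded_le (I : SNNInstance X k) {nn p p' : Fin k → X}
    (hnn : I.IsNearest nn) (hp : ∀ i, p i ∈ I.P) {τ : Fin k → Fin k}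
    (hτ : ∀ i j, dist (p i) (nn (τ i)) ≤ dist (p i) (nn j)) {K : ℝ} (hK : 0 ≤ K)
    (h : ∑ i, dist (p' i) (p i) ≤ K * ∑ i, dist (p i) (nn (τ i))) :
    ∑ i, dist (p' i) (I.q i) ≤ (2 * K + 1) * ∑ i, dist (p i) (I.q i) := by
  have h1 : ∑ i, dist (p' i) (I.q i) ≤ ∑ i, dist (p' i) (p i) + ∑ i, dist (p i) (I.q i) := by
    rw [← Finset.sum_add_distrib]
    exact Finset.sum_le_sum fun i _ => dist_triangle _ _ _
  have h2 : ∑ i, dist (p i) (nn (τ i)) ≤ 2 * ∑ i, dist (p i) (I.q i) := by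
    rw [Finset.mul_sum]
    exact Finset.sum_le_sum fun i _ => I.dist_nearest_terminal_le hnn hp hτ i
  linarith [mul_le_mul_of_nonneg_left h2 hK]

end Rounding

/-! ### Upper bound for padded decomposable spaces -/

section Padded

variable {X : Type u} [MetricSpace X]

/-- At scale `dist a b / 2` the two points are always separated, so 1 ≤ 2δ. This absorbs absolute
constants into multiples of δ. -/
theorem PaddedDecomposable.half_le {δ : ℝ} (h : PaddedDecomposable X δ) {a b : X} (hab : a ≠ b) :
    1 / 2 ≤ δ := by
  have hd : 0 < dist a b := dist_pos.2 hab
  obtain ⟨Ω, _, μ, _, part, hdiam, hsep⟩ := h (dist a b / 2) (by positivity)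
  have huniv : {ω | ¬ part ω a b} = Set.univ := by
    refine Set.eq_univ_of_forall fun ω hω => ?_
    linarith [hdiam ω a b hω]
  have h1 := (hsep a b).2
  rw [huniv, MeasureTheory.probReal_univ] at h1
  have h2 : δ * dist a b / (dist a b / 2) = 2 * δ := by field_simp
  rw [h2] at h1
  linarith

/-- Some outcome cuts no more pairs than the expected number. -/
theorem PaddedDecomposable.exists_partition {δ : ℝ} (h : PaddedDecomposable X δ) {k : ℕ}
    (p : Fin k → X) {r : ℝ} (hr : 0 < r) {E : Type*} (F : Finset E) (x y : E → Fin k) :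
    ∃ S : Setoid (Fin k), (∀ u v, S u v → dist (p u) (p v) ≤ r) ∧
      ∑ e ∈ F, (open Classical in if S (x e) (y e) then (0 : ℝ) else 1) ≤
        ∑ e ∈ F, δ * dist (p (x e)) (p (y e)) / r := by
  classical
  obtain ⟨Ω, _, μ, _, part, hdiam, hsep⟩ := h r hr
  let A : E → Set Ω := fun e => {ω | ¬ part ω (p (x e)) (p (y e))}
  have hA : ∀ e, MeasurableSet (A e) := fun e => (hsep _ _).1
  have hint : ∀ e ∈ F, MeasureTheory.Integrable ((A e).indicator fun _ => (1 : ℝ)) μ :=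
    fun e _ => (MeasureTheory.integrable_const _).indicator (hA e)
  obtain ⟨ω, hω⟩ := MeasureTheory.exists_le_integral
    (MeasureTheory.integrable_finsetSum F hint)
  refine ⟨Setoid.comap p (part ω), fun u v huv => hdiam ω _ _ huv, ?_⟩
  rw [MeasureTheory.integral_finsetSum _ hint] at hω
  refine le_trans (le_of_eq ?_) (hω.trans (Finset.sum_le_sum fun e _ => ?_))
  · refine Finset.sum_congr rfl fun e _ => ?_
    by_cases hs : part ω (p (x e)) (p (y e)) <;>
      simp [A, Setoid.comap_rel, hs]
  · rw [MeasureTheory.integral_indicator_const _ (hA e), smul_eq_mul, mul_one]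
    exact (hsep _ _).2

/-- Partitions at the scale of D itself suffice (j = 0): the cut cost exp ℓ cancels against the
separation probability, leaving δ d per edge. On the edges, 363 = 2 · 12 · 11 + 99. -/
theorem innGapOn_le {δ : ℝ} (h : PaddedDecomposable X δ) (k : ℕ) :
    innGapOn X k ≤ ENNReal.ofReal (363 * δ) := by
  simp only [innGapOn, iSup_le_iff]
  intro I nn hnn
  rcases subsingleton_or_nontrivial X with hX | hX
  · have hzero : ∀ p, I.assignmentCost p = 0 := fun p => by
      have h0 : ∀ a b : X, dist a b = 0 := fun a b => by rw [Subsingleton.elim a b, dist_self]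
      simp [SNNInstance.assignmentCost, h0]
    have : I.cost (Set.range nn) ≤ 0 := (I.cost_le fun i => Set.mem_range_self i).trans (hzero nn).le
    rw [SNNInstance.pruningGap, ENNReal.ofReal_of_nonpos this, ENNReal.zero_div]
    exact zero_le
  obtain ⟨a, b, hab⟩ := exists_pair_ne X
  have hδ : 1 / 2 ≤ δ := h.half_le hab
  refine I.pruningGap_le (by positivity) fun p hp => ?_
  obtain ⟨τ, hτ⟩ := SNNInstance.exists_nearest_terminal nn p
  obtain ⟨ℓ, N, -, hround⟩ := exists_rounding hτ I.G.fst I.G.snd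
  obtain ⟨S, hS, hcut⟩ := exists_partitions N I.G.fst I.G.snd (fun e => ℓ (I.G.fst e))
    (fun m S => ∀ u v, S u v → dist (p u) (p v) ≤ Real.exp (m + 0))
    (fun m e => δ * dist (p (I.G.fst e)) (p (I.G.snd e)) / Real.exp (m + 0))
    fun m => h.exists_partition p (Real.exp_pos _) _ _ _
  obtain ⟨p', hp', hq, he⟩ := hround 0 S hS
  refine ⟨p', hp', ?_⟩
  set K := Real.exp 2 + Real.exp (0 + 1) with hK
  have hE3 : Real.exp 1 ≤ 3 := by linarith [Real.exp_one_lt_d9]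
  have hK0 : 0 < K := by positivity
  have hK11 : K ≤ 11 := by
    have h1 : Real.exp 2 = Real.exp 1 * Real.exp 1 := by rw [← Real.exp_add]; norm_num
    rw [hK, zero_add, h1]
    nlinarith [Real.exp_one_lt_d9, Real.exp_pos 1]
  set Q := ∑ i, dist (p i) (I.q i) with hQ
  set W := ∑ e : I.G.Edge, dist (p (I.G.fst e)) (p (I.G.snd e)) with hW
  have hQ0 : 0 ≤ Q := Finset.sum_nonneg fun _ _ => dist_nonneg
  have hW0 : 0 ≤ W := Finset.sum_nonneg fun _ _ => dist_nonneg
  have hΓ : ∑ e ∈ N, Real.exp (ℓ (I.G.fst e)) *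
      (δ * dist (p (I.G.fst e)) (p (I.G.snd e)) / Real.exp (ℓ (I.G.fst e) + 0)) ≤ δ * W := by
    rw [hW, Finset.mul_sum]
    refine (Finset.sum_le_sum fun e _ => le_of_eq ?_).trans
      (Finset.sum_le_sum_of_subset_of_nonneg (Finset.subset_univ N) fun e _ _ => by positivity)
    rw [add_zero]
    field_simp
  have h1 := I.assignmentCost_rounded_le hnn hp hτ hK0.le hq
  have h2 := hcut.trans hΓ
  have hδW : 0 ≤ δ * W := by positivity
  have h3 : 3 * Real.exp 1 * K ≤ 99 := by nlinarith [Real.exp_pos 1]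
  have h4 := mul_le_mul_of_nonneg_left h2 (show 0 ≤ 3 * Real.exp 1 * K by positivity)
  have h5 := mul_le_mul_of_nonneg_right h3 hδW
  have h6 := mul_le_mul_of_nonneg_right hK11 hQ0
  have h7 := mul_le_mul_of_nonneg_right hK11 hW0
  have h8 := mul_le_mul_of_nonneg_right hδ hQ0
  have h9 := mul_le_mul_of_nonneg_right hδ hW0
  simp only [SNNInstance.assignmentCost]
  linarith

end Padded

/-! ### Upper bound for arbitrary metrics -/

section General

/-- Differences of stride two telescope to two terms at each end. -/
theorem sum_sub_two_le (g : ℕ → ℝ) {B : ℝ} (h0 : ∀ j, 0 ≤ g j) (hB : ∀ j, g j ≤ B) (m : ℕ) :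
    ∑ i ∈ Finset.range m, (g (i + 2) - g i) ≤ 2 * B := by
  have : ∀ m, ∑ i ∈ Finset.range m, (g (i + 2) - g i) = g (m + 1) + g m - (g 1 + g 0) := by
    intro m
    induction m with
    | zero => simp
    | succ m ih => rw [Finset.sum_range_succ, ih]; ring
  rw [this]
  linarith [h0 0, h0 1, hB m, hB (m + 1)]

theorem sum_exp_le (m : ℕ) : ∑ i ∈ Finset.range m, Real.exp i ≤ Real.exp m := by
  induction m with
  | zero => simp
  | succ m ih =>
    rw [Finset.sum_range_succ, Nat.cast_succ, Real.exp_add]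
    have h2 : 2 ≤ Real.exp 1 := by linarith [Real.exp_one_gt_d9]
    nlinarith [Real.exp_pos m]

variable {X : Type u} [MetricSpace X] {k : ℕ}

theorem logGrowth_nonneg (p : Fin k → X) (u v : Fin k) (s : ℝ) : 0 ≤ logGrowth p u v s :=
  Real.log_natCast_nonneg _

theorem logGrowth_le (p : Fin k → X) (u v : Fin k) {s : ℝ} (hs : 0 ≤ s) :
    logGrowth p u v s ≤ Real.log k := by
  refine Real.log_le_log ?_ ?_
  · exact_mod_cast Finset.card_pos.2 ⟨u, by simp [hs]⟩
  · exact_mod_cast (Finset.card_le_univ _).trans_eq (Fintype.card_fin k)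

theorem logGrowth_mono (p : Fin k → X) (u v : Fin k) {s t : ℝ} (hs : 0 ≤ s) (hst : s ≤ t) :
    logGrowth p u v s ≤ logGrowth p u v t := by
  refine Real.log_le_log ?_ ?_
  · exact_mod_cast Finset.card_pos.2 ⟨u, by simp [hs]⟩
  · refine Nat.cast_le.2 (Finset.card_le_card fun w hw => ?_)
    simp only [Finset.mem_filter, Finset.mem_univ, true_and] at hw ⊢
    exact hw.trans hst

theorem four_le_exp_two : (4 : ℝ) ≤ Real.exp 2 := by
  have h1 : Real.exp 2 = Real.exp 1 * Real.exp 1 := by rw [← Real.exp_add]; norm_num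
  rw [h1]
  nlinarith [Real.exp_one_gt_d9]

/-- For every `m`, one of the partition scales `1, …, m` is good for the rounding. -/
theorem SNNInstance.exists_rounded_le (I : SNNInstance X k) {nn p : Fin k → X}
    (hnn : I.IsNearest nn) (hp : ∀ i, p i ∈ I.P) {m : ℕ} (hm : 0 < m) :
    ∃ p' : Fin k → X, (∀ i, p' i ∈ Set.range nn) ∧
      m * I.assignmentCost p' ≤
        (26 * Real.exp 4 * Real.exp m + 48 * Real.exp 2 * Real.log k) * I.assignmentCost p := by
  obtain ⟨τ, hτ⟩ := SNNInstance.exists_nearest_terminal nn p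
  obtain ⟨ℓ, N, hNd, hround⟩ := exists_rounding hτ I.G.fst I.G.snd
  set d : I.G.Edge → ℝ := fun e => dist (p (I.G.fst e)) (p (I.G.snd e)) with hd
  have hd0 : ∀ e, 0 ≤ d e := fun _ => dist_nonneg
  let g : I.G.Edge → ℕ → ℝ := fun e i =>
    logGrowth p (I.G.fst e) (I.G.snd e) (Real.exp (ℓ (I.G.fst e) + (i + 1)) / 2)
  set Q := ∑ i, dist (p i) (I.q i) with hQ
  set W := ∑ e, d e with hW
  have hQ0 : 0 ≤ Q := Finset.sum_nonneg fun _ _ => dist_nonneg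
  have hW0 : 0 ≤ W := Finset.sum_nonneg fun _ _ => dist_nonneg
  have hcost : I.assignmentCost p = Q + W := rfl
  have key : ∀ i : ℕ, ∃ p' : Fin k → X, (∀ i, p' i ∈ Set.range nn) ∧
      I.assignmentCost p' ≤ 26 * Real.exp 4 * Real.exp i * (Q + W) +
        24 * Real.exp 2 * ∑ e ∈ N, d e * (g e (i + 2) - g e i) := by
    intro i
    -- Since e² ≥ 4, the offset 3 makes the edges in N at most one eighth of the cluster diameter,
    -- and the window from r / 8 to r / 2 is covered by two unit steps of `g`.
    set j : ℝ := i + 3 with hj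
    obtain ⟨S, hS, hcut⟩ := exists_partitions N I.G.fst I.G.snd (fun e => ℓ (I.G.fst e))
      (fun n S => ∀ u v, S u v → dist (p u) (p v) ≤ Real.exp (n + j))
      (fun n e => 4 * d e / Real.exp (n + j) *
        (logGrowth p (I.G.fst e) (I.G.snd e) (Real.exp (n + j) / 2) -
          logGrowth p (I.G.fst e) (I.G.snd e) (Real.exp (n + j) / 8)))
      fun n => exists_partition_card_cut_le p (Real.exp_pos _) _ _ _ fun e he => by
        obtain ⟨heN, rfl⟩ := Finset.mem_filter.1 he
        refine (hNd e heN).trans ?_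
        have h1 : Real.exp (ℓ (I.G.fst e) + 1) * 4 ≤ Real.exp (ℓ (I.G.fst e) + j) := by
          calc _ ≤ Real.exp (ℓ (I.G.fst e) + 1) * Real.exp 2 :=
                mul_le_mul_of_nonneg_left four_le_exp_two (Real.exp_pos _).le
            _ = Real.exp (ℓ (I.G.fst e) + 3) := by rw [← Real.exp_add]; ring_nf
            _ ≤ _ := Real.exp_le_exp.2 (by
              have : (0 : ℝ) ≤ i := Nat.cast_nonneg i
              linarith)
        linarith
    obtain ⟨p', hp', hq, he⟩ := hround j S hS
    refine ⟨p', hp', ?_⟩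
    set K := Real.exp 2 + Real.exp (j + 1) with hK
    have hK0 : 0 < K := by positivity
    have hi0 : (0 : ℝ) ≤ i := Nat.cast_nonneg i
    have hK2 : K ≤ 2 * Real.exp (j + 1) := by
      have : Real.exp 2 ≤ Real.exp (j + 1) := Real.exp_le_exp.2 (by linarith)
      linarith
    have hK1 : 1 ≤ K := by linarith [four_le_exp_two, Real.exp_pos (j + 1)]
    have hexp : Real.exp (j + 1) = Real.exp 4 * Real.exp i := by
      rw [← Real.exp_add, hj]; ring_nf
    have hg : ∀ e, logGrowth p (I.G.fst e) (I.G.snd e) (Real.exp (ℓ (I.G.fst e) + j) / 2) -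
        logGrowth p (I.G.fst e) (I.G.snd e) (Real.exp (ℓ (I.G.fst e) + j) / 8) ≤
        g e (i + 2) - g e i := fun e => by
      have h1 : Real.exp (ℓ (I.G.fst e) + (i + 1)) / 2 ≤ Real.exp (ℓ (I.G.fst e) + j) / 8 := by
        have : Real.exp (ℓ (I.G.fst e) + j) = Real.exp (ℓ (I.G.fst e) + (i + 1)) * Real.exp 2 := by
          rw [← Real.exp_add, hj]; ring_nf
        rw [this]
        nlinarith [four_le_exp_two, Real.exp_pos (ℓ (I.G.fst e) + ((i : ℝ) + 1))]
      have h2 := logGrowth_mono p (I.G.fst e) (I.G.snd e) (by positivity) h1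
      have h3 : g e (i + 2) =
          logGrowth p (I.G.fst e) (I.G.snd e) (Real.exp (ℓ (I.G.fst e) + j) / 2) := by
        simp only [g, hj]
        push_cast
        ring_nf
      rw [h3]
      exact sub_le_sub_left h2 _
    have hg0 : ∀ e, 0 ≤ g e (i + 2) - g e i := fun e => by
      refine sub_nonneg.2 (logGrowth_mono p _ _ (by positivity) ?_)
      have : Real.exp (ℓ (I.G.fst e) + ((i : ℝ) + 1)) ≤
          Real.exp (ℓ (I.G.fst e) + (((i + 2 : ℕ) : ℝ) + 1)) :=
        Real.exp_le_exp.2 (by push_cast; linarith)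
      linarith
    -- The factor K ≤ 2 exp (j + 1) cancels the exp (-j) of the cut bound, so only the growth
    -- depends on the scale.
    have hΓ : K * ∑ e ∈ N, Real.exp (ℓ (I.G.fst e)) * (open Classical in
        if S (ℓ (I.G.fst e)) (I.G.fst e) (I.G.snd e) then (0 : ℝ) else 1) ≤
        8 * Real.exp 1 * ∑ e ∈ N, d e * (g e (i + 2) - g e i) := by
      refine (mul_le_mul_of_nonneg_left hcut hK0.le).trans ?_
      rw [Finset.mul_sum, Finset.mul_sum]
      refine Finset.sum_le_sum fun e _ => ?_
      have h1 : Real.exp (ℓ (I.G.fst e) + j) = Real.exp (ℓ (I.G.fst e)) * Real.exp j :=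
        Real.exp_add _ _
      have h2 : Real.exp (ℓ (I.G.fst e)) * (4 * d e / Real.exp (ℓ (I.G.fst e) + j) *
          (logGrowth p (I.G.fst e) (I.G.snd e) (Real.exp (ℓ (I.G.fst e) + j) / 2) -
            logGrowth p (I.G.fst e) (I.G.snd e) (Real.exp (ℓ (I.G.fst e) + j) / 8))) ≤
          4 * d e / Real.exp j * (g e (i + 2) - g e i) := by
        have h3 : Real.exp (ℓ (I.G.fst e)) * (4 * d e / Real.exp (ℓ (I.G.fst e) + j)) =
            4 * d e / Real.exp j := by
          rw [h1]; field_simp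
        rw [← mul_assoc, h3]
        have := hd0 e
        exact mul_le_mul_of_nonneg_left (hg e) (by positivity)
      have hd0e := hd0 e
      calc K * _ ≤ K * (4 * d e / Real.exp j * (g e (i + 2) - g e i)) :=
            mul_le_mul_of_nonneg_left h2 hK0.le
        _ ≤ 2 * Real.exp (j + 1) * (4 * d e / Real.exp j * (g e (i + 2) - g e i)) :=
            mul_le_mul_of_nonneg_right hK2 (mul_nonneg (by positivity) (hg0 e))
        _ = 8 * Real.exp 1 * (d e * (g e (i + 2) - g e i)) := by
            rw [Real.exp_add]; field_simp; ring
    have h1 := I.assignmentCost_rounded_le hnn hp hτ hK0.le hq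
    have h2 := mul_le_mul_of_nonneg_left hΓ (show 0 ≤ 3 * Real.exp 1 by positivity)
    have h3 : Real.exp 2 = Real.exp 1 * Real.exp 1 := by rw [← Real.exp_add]; norm_num
    have h4 := mul_le_mul_of_nonneg_right hK2 hQ0
    have h5 := mul_le_mul_of_nonneg_right hK2 hW0
    have h6 := mul_le_mul_of_nonneg_right hK1 hQ0
    have h7 : 0 ≤ K * W := by positivity
    have h8 : 0 ≤ K * Q := by positivity
    rw [hexp] at h4 h5
    rw [h3]
    simp only [SNNInstance.assignmentCost]
    linarith
  choose f hf hle using key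
  -- Over all scales the movement costs form a geometric sum and the growth terms telescope to 2 log
  -- k per edge; some scale is no worse than the average.
  have hsum : ∑ i ∈ Finset.range m, I.assignmentCost (f i) ≤ ∑ i ∈ Finset.range m,
      ((26 * Real.exp 4 * Real.exp m + 48 * Real.exp 2 * Real.log k) *
        I.assignmentCost p / m) := by
    refine (Finset.sum_le_sum fun i _ => hle i).trans ?_
    rw [Finset.sum_const, Finset.card_range, nsmul_eq_mul, Finset.sum_add_distrib,
      ← Finset.mul_sum, ← Finset.sum_mul, ← Finset.mul_sum, Finset.sum_comm,
      mul_div_cancel₀ _ (by exact_mod_cast hm.ne'), hcost]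
    have h1 : ∑ e ∈ N, ∑ i ∈ Finset.range m, d e * (g e (i + 2) - g e i) ≤
        W * (2 * Real.log k) := by
      rw [hW, Finset.sum_mul]
      refine (Finset.sum_le_sum fun e _ => ?_).trans
        (Finset.sum_le_sum_of_subset_of_nonneg (Finset.subset_univ N) fun e _ _ =>
          mul_nonneg (hd0 e) (by positivity))
      rw [← Finset.mul_sum]
      exact mul_le_mul_of_nonneg_left (sum_sub_two_le (g e) (fun _ => logGrowth_nonneg _ _ _ _)
        (fun _ => logGrowth_le _ _ _ (by positivity)) m) (hd0 e)
    have h2 := mul_le_mul_of_nonneg_left h1 (show 0 ≤ 24 * Real.exp 2 by positivity)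
    have h3 := mul_le_mul_of_nonneg_right (mul_le_mul_of_nonneg_left (sum_exp_le m)
      (show 0 ≤ 26 * Real.exp 4 by positivity)) (show 0 ≤ Q + W by positivity)
    have h4 : 0 ≤ 48 * Real.exp 2 * Real.log k * Q := by positivity
    linarith
  obtain ⟨i, -, hi⟩ := Finset.exists_le_of_sum_le (by simpa using hm.ne') hsum
  refine ⟨f i, hf i, ?_⟩
  rwa [le_div_iff₀ (by exact_mod_cast hm), mul_comm] at hi

theorem innGap_le {k : ℕ} (hk : 3 ≤ k) :
    innGap.{u} k ≤ ENNReal.ofReal (7000 * (Real.log k / Real.log (Real.log k))) := by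
  have hk3 : (3 : ℝ) ≤ k := by exact_mod_cast hk
  have hlog1 : 1 < Real.log k := by
    rw [Real.lt_log_iff_exp_lt (by linarith)]
    linarith [Real.exp_one_lt_d9]
  have hll : 0 < Real.log (Real.log k) := Real.log_pos hlog1
  simp only [innGap, iSup_le_iff]
  intro X _ I nn hnn
  refine I.pruningGap_le (by positivity) fun p hp => ?_
  -- This is the balance point: exp m is still at most 3 log k, while m ≥ log log k is the gain from
  -- averaging.
  set m := ⌈Real.log (Real.log k)⌉₊ with hm
  have hm0 : 0 < m := Nat.ceil_pos.2 hll
  have hm1 : Real.log (Real.log k) ≤ m := Nat.le_ceil _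
  have hm2 : (m : ℝ) < Real.log (Real.log k) + 1 := Nat.ceil_lt_add_one hll.le
  obtain ⟨p', hp', hle⟩ := I.exists_rounded_le hnn hp hm0
  refine ⟨p', hp', ?_⟩
  have hA := I.assignmentCost_nonneg p
  have hE3 : Real.exp 1 ≤ 3 := by linarith [Real.exp_one_lt_d9]
  have hexpm : Real.exp m ≤ 3 * Real.log k := by
    calc Real.exp m ≤ Real.exp (Real.log (Real.log k) + 1) := Real.exp_le_exp.2 hm2.le
      _ = Real.log k * Real.exp 1 := by rw [Real.exp_add, Real.exp_log (by linarith)]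
      _ ≤ 3 * Real.log k := by nlinarith
  have hE4 : Real.exp 4 ≤ 81 := by
    have : Real.exp 4 = Real.exp 1 ^ 4 := by rw [← Real.exp_nat_mul]; norm_num
    rw [this]
    calc Real.exp 1 ^ 4 ≤ 3 ^ 4 := by gcongr
      _ = 81 := by norm_num
  have hE2 : Real.exp 2 ≤ 9 := by
    have : Real.exp 2 = Real.exp 1 ^ 2 := by rw [← Real.exp_nat_mul]; norm_num
    rw [this]
    calc Real.exp 1 ^ 2 ≤ 3 ^ 2 := by gcongr
      _ = 9 := by norm_num
  have hcoef : 26 * Real.exp 4 * Real.exp m + 48 * Real.exp 2 * Real.log k ≤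
      7000 * Real.log k := by
    have h1 : Real.exp 4 * Real.exp m ≤ 81 * (3 * Real.log k) := by gcongr
    have h2 : Real.exp 2 * Real.log k ≤ 9 * Real.log k := by gcongr
    linarith
  have h1 : Real.log (Real.log k) * I.assignmentCost p' ≤ 7000 * Real.log k * I.assignmentCost p :=
    (mul_le_mul_of_nonneg_right hm1 (I.assignmentCost_nonneg p')).trans
      (hle.trans (mul_le_mul_of_nonneg_right hcoef hA))
  calc I.assignmentCost p' ≤ 7000 * Real.log k * I.assignmentCost p / Real.log (Real.log k) := by
        rw [le_div_iff₀ hll, mul_comm]; exact h1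
    _ = _ := by ring

end General

end SNN
open SNN in
theorem mainTheorem1 :
    -- `α = O(log k / log log k)`
    (∃ C : ℝ, 0 < C ∧ ∀ k : ℕ, 3 ≤ k →
      innGap.{u} k ≤ ENNReal.ofReal (C * (Real.log k / Real.log (Real.log k)))) ∧
    -- `α = O(δ)` on `δ`-padded decomposable metric spaces
    (∃ C : ℝ, 0 < C ∧ ∀ (X : Type u) [MetricSpace X] (δ : ℝ), PaddedDecomposable X δ →
      ∀ k : ℕ, innGapOn X k ≤ ENNReal.ofReal (C * δ)) ∧
    -- `α = O(r)` for compatibility graphs of pseudoarboricity `r`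
    (∃ C : ℝ, 0 < C ∧ ∀ r k : ℕ,
      innGapPseudoarb.{u} r k ≤ ENNReal.ofReal (C * max 1 (r : ℝ))) ∧
    -- `α = Ω(√log k)`
    (∃ c : ℝ, 0 < c ∧ ∀ k : ℕ,
      ∃ (X : Type u) (_ : MetricSpace X) (I : SNNInstance X k),
        Function.Injective I.q ∧
        ∀ nn : Fin k → X, I.IsNearest nn →
          ENNReal.ofReal (c * Real.sqrt (Real.log k)) ≤ I.pruningGap nn) ∧
    -- `α = Ω(r)` for compatibility graphs of pseudoarboricity `r ≤ √log k`
    (∃ c : ℝ, 0 < c ∧ ∀ k r : ℕ, (r : ℝ) ≤ Real.sqrt (Real.log k) →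
      ∃ (X : Type u) (_ : MetricSpace X) (I : SNNInstance X k),
        Function.Injective I.q ∧ I.G.pseudoarboricity = r ∧
        ∀ nn : Fin k → X, I.IsNearest nn →
          ENNReal.ofReal (c * r) ≤ I.pruningGap nn) := by
  exact ⟨⟨7000, by norm_num, fun k hk => innGap_le hk⟩,
    ⟨363, by norm_num, fun X _ δ h k => innGapOn_le h k⟩,
    ⟨7, by norm_num, innGapPseudoarb_le⟩,
    ⟨1 / 1024, by norm_num, exists_instance_sqrt_log⟩,
    ⟨1 / 512, by norm_num, exists_instance_pseudoarboricity⟩⟩
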